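/- All graphs are finite, simple and undirected; a class of graphs is closed under isomorphism. A class $\mathcal{G}$ is *sustainable* if for every $G\in\mathcal{G}$ there are a graph $G'\in\mathcal{G}$ and a vertex $v\in V(G')$ such that $G'-v$ is (isomorphic to) $G$. For $k\ge 1$, the decision version of *Fair $k$-Division Under Conflicts* with conflict graphs from $\mathcal{G}$ is the following problem: given a graph $G=(V,E)\in\mathcal{G}$, profit functions $p_1,\dots,p_k:V\to\mathbb{Z}_{\ge 0}$ and a number $q\in\mathbb{Z}_{\ge 0}$, are there pairwise disjoint independent sets $X_1,\dots,X_k$ of $G$ with $\min_{1\le j\le k}\sum_{v\in X_j}p_j(v)\ge q$? The decision version of *Independent Set* on $\mathcal{G}$ asks, given $G\in\mathcal{G}$ and $q\in\mathbb{Z}_{\ge 0}$, whether $G$ has an independent set with at least $q$ vertices. NP-completeness is with respect to polynomial-time many-one reductions, numbers being written in binary; a problem is *strongly NP-complete* if it is in NP and, for some polynomial $p$, its restriction to the instances $I$ in which every number is at most $p(|I|)$ is NP-complete. (a) Let $\mathcal{G}$ be a sustainable class of graphs on which the decision version of Independent Set is NP-complete. Then, for every $k\ge 1$, the decision version of Fair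 $k$-Division Under Conflicts with conflict graphs from $\mathcal{G}$ is strongly NP-complete. (b) For every graph $H$ with at least two vertices, the class of $H$-free graphs (the graphs with no induced subgraph isomorphic to $H$) is sustainable. Consequently, if the decision version of Independent Set is NP-complete on $H$-free graphs, then, for every $k\ge 1$, the decision version of Fair $k$-Division Under Conflicts with $H$-free conflict graphs is strongly NP-complete. -/

import Mathlib

open Turing Computability

/-! ## Decision problems, NP, strong NP-completeness

Machines are Mathlib's multi-stack Turing machines `Turing.FinTM2`; polynomial-time computability is
Mathlib's `Turing.TM2ComputableInPolyTime` (number of machine steps bounded by a polynomial in the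
length of the encoded input). The alphabet is Mathlib's standard finite machine alphabet `Γ'`. -/

/-- A decision problem: a type of instances, an encoding of the instances as words over the finite
alphabet `Γ'`, and the set of yes-instances. -/
structure DecisionProblem where
  /-- the instances -/
  Inst : Type
  /-- the encoding of instances -/
  enc : Inst → List Γ'
  enc_injective : Function.Injective enc
  /-- the yes-instances -/
  yes : Set Inst

namespace DecisionProblem

/-- The word `enc x # w` that is handed to a verifier, for an instance `x` and a certificate `w`. -/
def encPair (P : DecisionProblem) (z : P.Inst × List Bool) : List Γ' :=
  P.enc z.1 ++ Γ'.ket :: z.2.map Γ'.bit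

/-- `P` is in NP: some polynomial-time verifier accepts an instance together with some certificate
of polynomially bounded length exactly if the instance is a yes-instance. -/
def InNP (P : DecisionProblem) : Prop :=
  ∃ (p : Polynomial ℕ) (V : P.Inst × List Bool → Bool),
    Nonempty (TM2ComputableInPolyTime P.encPair encodeBool V) ∧
    ∀ x, x ∈ P.yes ↔ ∃ w : List Bool, w.length ≤ p.eval (P.enc x).length ∧ V (x, w) = true

/-- Polynomial-time many-one (Karp) reducibility. -/
def ReducesTo (P Q : DecisionProblem) : Prop :=
  ∃ f : P.Inst → Q.Inst, Nonempty (TM2ComputableInPolyTime P.enc Q.enc f) ∧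
    ∀ x, x ∈ P.yes ↔ f x ∈ Q.yes

/-- The decision problem "does the word belong to `L`?", for a language `L` of binary words. -/
def ofLanguage (L : Language Bool) : DecisionProblem where
  Inst := List Bool
  enc w := w.map Γ'.bit
  enc_injective := List.map_injective_iff.mpr fun _ _ h => by simpa using h
  yes := {w | w ∈ L}

/-- `P` is NP-hard: every language in NP reduces to it. -/
def NPHard (P : DecisionProblem) : Prop :=
  ∀ L : Language Bool, (ofLanguage L).InNP → (ofLanguage L).ReducesTo P

/-- `P` is NP-complete. -/
def NPComplete (P : DecisionProblem) : Prop :=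
  P.InNP ∧ P.NPHard

end DecisionProblem

/-- A decision problem whose instances contain natural numbers (written in binary), together with
the function `Max` giving the largest number that occurs in an instance. -/
structure NumberProblem extends DecisionProblem where
  /-- the largest number occurring in the instance -/
  maxNum : Inst → ℕ

namespace NumberProblem

/-- The problem `P` restricted to the instances `x` with `Max x ≤ p (length x)`. -/
def restrict (P : NumberProblem) (p : Polynomial ℕ) : DecisionProblem where
  Inst := {x : P.Inst // P.maxNum x ≤ p.eval (P.enc x).length}
  enc x := P.enc x.1
  enc_injective := P.enc_injective.comp Subtype.val_injective
  yes := {x | x.1 ∈ P.yes}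

/-- `P` is strongly NP-complete (Garey and Johnson): it is in NP, and for some polynomial `p` its
restriction to the instances with `Max x ≤ p (length x)` is NP-complete. -/
def StronglyNPComplete (P : NumberProblem) : Prop :=
  P.toDecisionProblem.InNP ∧ ∃ p : Polynomial ℕ, (P.restrict p).NPComplete

end NumberProblem

/-! ## Graph classes -/

/-- A class of finite simple graphs, closed under isomorphism. Every finite graph is isomorphic to
one with vertex set `Fin n`, so it is given by its members of this form. -/
structure GraphClass where
  /-- membership in the class -/
  Mem : ∀ {n : ℕ}, SimpleGraph (Fin n) → Prop
  mem_of_iso : ∀ {n m : ℕ} {G : SimpleGraph (Fin n)} {G' : SimpleGraph (Fin m)},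
    Nonempty (G ≃g G') → Mem G → Mem G'

namespace GraphClass

/-- Every graph `G` in the class is `G' - v` for a graph `G'` in the class and a vertex `v`. -/
def Sustainable (𝒢 : GraphClass) : Prop :=
  ∀ (n : ℕ) (G : SimpleGraph (Fin n)), 𝒢.Mem G →
    ∃ (m : ℕ) (G' : SimpleGraph (Fin m)) (v : Fin m),
      𝒢.Mem G' ∧ Nonempty (G'.induce {v}ᶜ ≃g G)

/-- The class of `H`-free graphs: no induced subgraph is isomorphic to `H`. -/
def free {W : Type*} (H : SimpleGraph W) : GraphClass where
  Mem G := ¬ H.IsIndContained G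
  mem_of_iso := fun ⟨e⟩ hG ⟨i⟩ => hG ⟨e.symm.toEmbedding.comp i⟩

end GraphClass

/-! ## Encoding of graphs and numbers

An instance is written as a sequence of binary words, each terminated by a comma. A graph on `n`
vertices is written as `n` in unary followed by the `n` rows of its adjacency matrix; numbers are
written in binary. -/

/-- A sequence of binary words as a single word, each of them followed by a comma. -/
def encodeFields (l : List (List Bool)) : List Γ' :=
  l.flatMap fun b => b.map Γ'.bit ++ [Γ'.comma]

open Classical in
/-- The fields describing a graph: the number of vertices in unary and the adjacency matrix. -/
noncomputable def graphFields {n : ℕ} (G : SimpleGraph (Fin n)) : List (List Bool) :=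
  List.replicate n true :: List.ofFn fun u => List.ofFn fun v => decide (G.Adj u v)

/-- The fields describing a family of profit functions: the values of the first function, then
those of the second function, and so on, in binary. -/
def profitFields {k n : ℕ} (p : Fin k → Fin n → ℕ) : List (List Bool) :=
  (List.ofFn fun j => List.ofFn fun v => encodeNat (p j v)).flatten

theorem encodeFields_injective : Function.Injective encodeFields := by
  have key : ∀ (b b' : List Bool) (s s' : List Γ'),
      b.map Γ'.bit ++ Γ'.comma :: s = b'.map Γ'.bit ++ Γ'.comma :: s' → b = b' ∧ s = s' := by
    intro b
    induction b with
    | nil => intro b' s s' h; cases b' <;> simp_all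
    | cons a b ih =>
      intro b' s s' h
      cases b' with
      | nil => simp at h
      | cons a' b' =>
        simp only [List.map_cons, List.cons_append, List.cons.injEq, Γ'.bit.injEq] at h
        obtain ⟨h1, h2⟩ := ih _ _ _ h.2
        simp [h.1, h1, h2]
  intro l
  induction l with
  | nil => intro l' h; cases l' <;> simp_all [encodeFields]
  | cons b l ih =>
    intro l' h
    cases l' with
    | nil => simp [encodeFields] at h
    | cons b' l' =>
      simp only [encodeFields, List.flatMap_cons, List.append_assoc, List.singleton_append] at h
      obtain ⟨h1, h2⟩ := key _ _ _ _ h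
      rw [h1, ih h2]

theorem encodeNat_injective : Function.Injective encodeNat :=
  encodingNatBool.encode_injective

theorem graphFields_append_inj {n m : ℕ} {G : SimpleGraph (Fin n)} {G' : SimpleGraph (Fin m)}
    {s s' : List (List Bool)} (h : graphFields G ++ s = graphFields G' ++ s') :
    (⟨n, G⟩ : Σ n, SimpleGraph (Fin n)) = ⟨m, G'⟩ ∧ s = s' := by
  simp only [graphFields, List.cons_append, List.cons.injEq] at h
  obtain rfl : n = m := by simpa using congrArg List.length h.1
  obtain ⟨h1, h2⟩ := List.append_inj h.2 (by simp)
  refine ⟨?_, h2⟩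
  congr 1
  ext u v
  have := congrFun (List.ofFn_injective (congrFun (List.ofFn_injective h1) u)) v
  simpa using this

theorem profitFields_append_inj {n : ℕ} {k : ℕ} {p p' : Fin k → Fin n → ℕ}
    {s s' : List (List Bool)} (h : profitFields p ++ s = profitFields p' ++ s') :
    p = p' ∧ s = s' := by
  induction k with
  | zero => exact ⟨Subsingleton.elim _ _, by simpa [profitFields] using h⟩
  | succ k ih =>
    simp only [profitFields, List.ofFn_succ (n := k), List.flatten_cons, List.append_assoc] at h
    obtain ⟨h1, h2⟩ := List.append_inj h (by simp)
    obtain ⟨h3, h4⟩ := ih (p := fun j => p j.succ) (p' := fun j => p' j.succ) h2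
    refine ⟨?_, h4⟩
    funext j v
    refine Fin.cases ?_ (fun j => congrFun (congrFun h3 j) v) j
    exact encodeNat_injective (congrFun (List.ofFn_injective h1) v)

/-! ## Independent Set -/

/-- An input of Independent Set (decision version): a graph and a number. -/
structure IndepSetInput where
  /-- the number of vertices -/
  n : ℕ
  /-- the graph -/
  graph : SimpleGraph (Fin n)
  /-- the required size -/
  target : ℕ

/-- The encoding of an input of Independent Set. -/
noncomputable def IndepSetInput.encode (x : IndepSetInput) : List Γ' :=
  encodeFields (graphFields x.graph ++ [encodeNat x.target])

theorem IndepSetInput.encode_injective : Function.Injective IndepSetInput.encode := by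
  rintro ⟨n, G, q⟩ ⟨n', G', q'⟩ h
  obtain ⟨h1, h2⟩ := graphFields_append_inj (encodeFields_injective h)
  obtain rfl : q = q' := encodeNat_injective (by simpa using h2)
  cases h1
  rfl

/-- Independent Set (decision version) on the class `𝒢`: given a graph `G` in `𝒢` and a number `q`,
does `G` have an independent set with at least `q` vertices? -/
noncomputable def IndependentSet (𝒢 : GraphClass) : DecisionProblem where
  Inst := {x : IndepSetInput // 𝒢.Mem x.graph}
  enc x := x.1.encode
  enc_injective := IndepSetInput.encode_injective.comp Subtype.val_injective
  yes := {x | ∃ X : Finset (Fin x.1.n), x.1.graph.IsIndepSet X ∧ x.1.target ≤ X.card}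

/-! ## Fair `k`-Division Under Conflicts -/

/-- `(X 0, …, X (k - 1))` is a partial `k`-coloring of `G`: a sequence of pairwise disjoint
independent sets. -/
def IsPartialColoring {k n : ℕ} (G : SimpleGraph (Fin n)) (X : Fin k → Finset (Fin n)) : Prop :=
  Pairwise (fun i j => Disjoint (X i) (X j)) ∧ ∀ j, G.IsIndepSet (X j)

/-- The satisfaction level `min_j p_j(X_j)` (for `k ≥ 1`). -/
noncomputable def satisfactionLevel {k n : ℕ} (p : Fin k → Fin n → ℕ)
    (X : Fin k → Finset (Fin n)) : ℕ :=
  ⨅ j, ∑ v ∈ X j, p j v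

/-- An input of Fair `k`-Division Under Conflicts (decision version): a conflict graph, `k` profit
functions and a number. -/
structure FairDivisionInput (k : ℕ) where
  /-- the number of vertices -/
  n : ℕ
  /-- the conflict graph -/
  graph : SimpleGraph (Fin n)
  /-- the profit functions -/
  profit : Fin k → Fin n → ℕ
  /-- the required satisfaction level -/
  target : ℕ

/-- The encoding of an input of Fair `k`-Division Under Conflicts. -/
noncomputable def FairDivisionInput.encode {k : ℕ} (x : FairDivisionInput k) : List Γ' :=
  encodeFields (graphFields x.graph ++ (profitFields x.profit ++ [encodeNat x.target]))

theorem FairDivisionInput.encode_injective {k : ℕ} :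
    Function.Injective (FairDivisionInput.encode (k := k)) := by
  rintro ⟨n, G, p, q⟩ ⟨n', G', p', q'⟩ h
  obtain ⟨h1, h2⟩ := graphFields_append_inj (encodeFields_injective h)
  cases h1
  obtain ⟨rfl, h3⟩ := profitFields_append_inj h2
  obtain rfl : q = q' := encodeNat_injective (by simpa using h3)
  rfl

/-- Fair `k`-Division Under Conflicts (decision version) with conflict graphs from `𝒢`: given a
graph `G` in `𝒢`, profit functions `p_1, …, p_k` and a number `q`, does `G` have a partial
`k`-coloring with satisfaction level at least `q`? The numbers in an instance are the profits
and `q`. -/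
noncomputable def FairDivision (k : ℕ) (𝒢 : GraphClass) : NumberProblem where
  Inst := {x : FairDivisionInput k // 𝒢.Mem x.graph}
  enc x := x.1.encode
  enc_injective := FairDivisionInput.encode_injective.comp Subtype.val_injective
  yes := {x | ∃ X : Fin k → Finset (Fin x.1.n),
    IsPartialColoring x.1.graph X ∧ x.1.target ≤ satisfactionLevel x.1.profit X}
  maxNum x := max x.1.target
    (Finset.univ.sup fun j => Finset.univ.sup fun v => x.1.profit j v)

/-! Part (a). The reduction keeps the graph. Let `k = K + 1` and let `(G, q)` be an instance of
Independent Set with `n` vertices. If `q + K ≤ n`, the target is `q`, every vertex is worth `1` to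
the first agent and `q` to each of the other `K` agents. An independent set of at least `q` vertices
can be cut down to exactly `q`; then `K` distinct vertices remain outside, and each of them, as a
singleton, satisfies one of the other agents. Conversely, the set of the first agent is independent
and has at least `q` vertices. If `q + K > n`, an independent set with at least `q` vertices misses
fewer than `K` vertices. As `K` is a constant, all sets of at most `K` vertices can be tried as
complements in polynomial time, and the answer is written as a trivial yes- or no-instance on the
same graph (`search_graphFields_iff`, `newInput_correct`). All numbers produced are at most `n + 1`,
and `n` is written in unary, so hardness holds even when numbers are bounded by the input length.
For membership in NP the certificate consists of `k` characteristic vectors (`verify_eq_true_iff`).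

The algorithms must become Turing machines. Structured stack programs compile to `FinTM2` with the
same number of steps (`Exec.steps`). Data are binary trees, stored on a stack by their prefix codes.
The functions computed on such codes in polynomial time (`PolyTime`) are closed under composition,
pairing, case distinction and folds with polynomially bounded states, so that the algorithms can be
written as ordinary functions on lists. `computableInPolyTime_of_polyTime` runs such a function
after an arbitrary machine, here the one of the given reduction to Independent Set.

Part (b). A graph `H` with at least two vertices cannot have both an isolated and a universal
vertex. Adding to `G` a vertex of a kind that `H` lacks creates no induced copy of `H`, since a copy
through the new vertex would give `H` a vertex of that kind (`IsIndContained.of_addVertex`). -/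

/-! ## Structured stack programs and their compilation to `FinTM2` -/

namespace StackMachine

open Function

/-- Structured programs on a family of stacks. `pop` removes the top of a stack and branches on a
finite classification of it; `peek` does not remove it; `loop` does so repeatedly until the classification is `none`. -/
inductive Prog (K : Type) (Γ : K → Type) : Type 1
  | skip : Prog K Γ
  | push (k : K) (a : Γ k) : Prog K Γ
  | pop (k : K) (ι : Type) (hι : Fintype ι) (cls : Option (Γ k) → ι) (f : ι → Prog K Γ) : Prog K Γ
  | peek (k : K) (ι : Type) (hι : Fintype ι) (cls : Option (Γ k) → ι) (f : ι → Prog K Γ) : Prog K Γ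
  | seq (p q : Prog K Γ) : Prog K Γ
  | loop (k : K) (ι : Type) (hι : Fintype ι) (cls : Option (Γ k) → Option ι)
      (f : ι → Prog K Γ) : Prog K Γ

variable {K : Type} {Γ : K → Type}

/-- `Exec p S S' t`: started with stacks `S`, the program `p` stops with stacks `S'` after `t`
steps. -/
inductive Exec [DecidableEq K] :
    Prog K Γ → (∀ k, List (Γ k)) → (∀ k, List (Γ k)) → ℕ → Prop
  | skip (S) : Exec .skip S S 0
  | push (k a S) : Exec (.push k a) S (update S k (a :: S k)) 1
  | pop {k ι hι cls f S S' t} (h : Exec (f (cls (S k).head?)) (update S k (S k).tail) S' t) :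
      Exec (.pop k ι hι cls f) S S' (t + 1)
  | peek {k ι hι cls f S S' t} (h : Exec (f (cls (S k).head?)) S S' t) :
      Exec (.peek k ι hι cls f) S S' (t + 1)
  | seq {p q S₁ S₂ S₃ t₁ t₂} (h₁ : Exec p S₁ S₂ t₁) (h₂ : Exec q S₂ S₃ t₂) :
      Exec (.seq p q) S₁ S₃ (t₁ + t₂)
  | loop_exit {k ι hι cls f S} (h : cls (S k).head? = none) :
      Exec (.loop k ι hι cls f) S (update S k (S k).tail) 1
  | loop_step {k ι hι cls f S S₁ S₂ t₁ t₂ i} (h : cls (S k).head? = some i)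
      (h₁ : Exec (f i) (update S k (S k).tail) S₁ t₁)
      (h₂ : Exec (.loop k ι hι cls f) S₁ S₂ t₂) :
      Exec (.loop k ι hι cls f) S S₂ (t₁ + t₂ + 1)

/-- One step pushes at most one symbol. Time bounds thereby become bounds on the size of outputs. -/
theorem Exec.length_le [DecidableEq K] {p : Prog K Γ} {S S' t} (h : Exec p S S' t) (k : K) :
    (S' k).length ≤ (S k).length + t := by
  have key : ∀ (S : ∀ k, List (Γ k)) (k' : K),
      (update S k' (S k').tail k).length ≤ (S k).length := by
    intro S k'
    by_cases e : k = k'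
    · subst e; simp
    · simp [e]
  induction h with
  | skip => simp
  | push k' a S =>
    by_cases e : k = k'
    · subst e; simp
    · simp [e]
  | @pop k' _ _ _ _ S _ _ _ ih => have := key S k'; omega
  | peek _ ih => omega
  | seq _ _ ih₁ ih₂ => omega
  | @loop_exit k' _ _ _ _ S _ => have := key S k'; omega
  | @loop_step k' _ _ _ _ S _ _ _ _ _ _ _ _ ih₁ ih₂ => have := key S k'; omega

namespace Prog

/-- The labels needed to compile a program. -/
def Lab : Prog K Γ → Type
  | skip => Empty
  | push _ _ => Unit
  | pop _ ι _ _ f => Option (Σ i : ι, (f i).Lab)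
  | peek _ ι _ _ f => Option (Σ i : ι, (f i).Lab)
  | seq p q => p.Lab ⊕ q.Lab
  | loop _ ι _ _ f => Option (Σ i : ι, (f i).Lab)

theorem finite_lab (p : Prog K Γ) : Finite p.Lab := by
  induction p with
  | skip => exact inferInstanceAs (Finite Empty)
  | push => exact inferInstanceAs (Finite Unit)
  | pop k ι hι cls f ih => exact inferInstanceAs (Finite (Option (Σ i : ι, (f i).Lab)))
  | peek k ι hι cls f ih => exact inferInstanceAs (Finite (Option (Σ i : ι, (f i).Lab)))
  | seq p q ih₁ ih₂ => exact inferInstanceAs (Finite (p.Lab ⊕ q.Lab))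
  | loop k ι hι cls f ih => exact inferInstanceAs (Finite (Option (Σ i : ι, (f i).Lab)))

variable {Λ : Type}

/-- The first label of a compiled program. -/
def enter : (p : Prog K Γ) → (p.Lab → Λ) → Λ → Λ
  | skip, _, exit => exit
  | push _ _, e, _ => e ()
  | pop _ _ _ _ _, e, _ => e none
  | peek _ _ _ _ _, e, _ => e none
  | seq p q, e, exit => p.enter (fun l => e (.inl l)) (q.enter (fun l => e (.inr l)) exit)
  | loop _ _ _ _ _, e, _ => e none

/-- The statement attached to a label of a compiled program. The internal state of the machine is
used to hold the next label. -/
def code : (p : Prog K Γ) → (p.Lab → Λ) → Λ → p.Lab → TM2.Stmt Γ Λ Λ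
  | skip, _, _, l => nomatch (show Empty from l)
  | push k a, _, exit, _ => .push k (fun _ => a) (.goto fun _ => exit)
  | pop k _ _ cls f, e, exit, none =>
    .pop k (fun _ o => (f (cls o)).enter (fun l => e (some ⟨cls o, l⟩)) exit) (.goto fun s => s)
  | pop _ _ _ _ f, e, exit, some l => (f l.1).code (fun l' => e (some ⟨l.1, l'⟩)) exit l.2
  | peek k _ _ cls f, e, exit, none =>
    .peek k (fun _ o => (f (cls o)).enter (fun l => e (some ⟨cls o, l⟩)) exit) (.goto fun s => s)
  | peek _ _ _ _ f, e, exit, some l => (f l.1).code (fun l' => e (some ⟨l.1, l'⟩)) exit l.2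
  | seq p q, e, exit, .inl l =>
    p.code (fun l => e (.inl l)) (q.enter (fun l => e (.inr l)) exit) l
  | seq _ q, e, exit, .inr l => q.code (fun l => e (.inr l)) exit l
  | loop k _ _ cls f, e, exit, none =>
    .pop k (fun _ o => (cls o).elim exit fun i =>
      (f i).enter (fun l => e (some ⟨i, l⟩)) (e none)) (.goto fun s => s)
  | loop _ _ _ _ f, e, _, some l => (f l.1).code (fun l' => e (some ⟨l.1, l'⟩)) (e none) l.2

end Prog

/-! ### Correctness of the compilation -/

/-- `c` reaches `c'` in exactly `t` steps. -/
def Steps [DecidableEq K] {Λ σ : Type} (m : Λ → TM2.Stmt Γ Λ σ) (t : ℕ)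
    (c c' : TM2.Cfg Γ Λ σ) : Prop :=
  (flip bind (TM2.step m))^[t] (some c) = some c'

theorem Steps.trans [DecidableEq K] {Λ σ : Type} {m : Λ → TM2.Stmt Γ Λ σ} {t₁ t₂ : ℕ}
    {c₁ c₂ c₃ : TM2.Cfg Γ Λ σ} (h₁ : Steps m t₁ c₁ c₂) (h₂ : Steps m t₂ c₂ c₃) :
    Steps m (t₁ + t₂) c₁ c₃ := by
  unfold Steps at *
  rw [add_comm, iterate_add_apply, h₁, h₂]

theorem Steps.one [DecidableEq K] {Λ σ : Type} {m : Λ → TM2.Stmt Γ Λ σ} {l : Λ} {v : σ}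
    {S : ∀ k, List (Γ k)} {q : TM2.Stmt Γ Λ σ} (h : m l = q) :
    Steps m 1 ⟨some l, v, S⟩ (TM2.stepAux q v S) := by
  subst h; rfl

/-- Sequencing costs nothing, since the exit of the first program is the entry of the second; every
other construct costs one machine step, so the time carries over exactly. The code may sit inside a
larger machine, via `e`. The internal state is arbitrary before and after: every branch overwrites
it with the next label before the jump reads it. -/
theorem Exec.steps [DecidableEq K] {p : Prog K Γ} {S S' t} (h : Exec p S S' t) :
    ∀ {Λ : Type} (m : Λ → TM2.Stmt Γ Λ Λ) (e : p.Lab → Λ) (exit : Λ),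
      (∀ l, m (e l) = p.code e exit l) → ∀ v, ∃ v',
        Steps m t ⟨some (p.enter e exit), v, S⟩ ⟨some exit, v', S'⟩ := by
  induction h with
  | skip S => exact fun m e exit _ v => ⟨v, rfl⟩
  | push k a S => exact fun m e exit hm v => ⟨v, Steps.one (hm ())⟩
  | @pop k ι hι cls f S S' t _ ih =>
    intro Λ m e exit hm v
    obtain ⟨v', hv⟩ := ih m (fun l => e (some ⟨_, l⟩)) exit (fun l => hm (some ⟨_, l⟩)) _
    exact ⟨v', add_comm 1 t ▸ (Steps.one (hm none)).trans hv⟩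
  | @peek k ι hι cls f S S' t _ ih =>
    intro Λ m e exit hm v
    obtain ⟨v', hv⟩ := ih m (fun l => e (some ⟨_, l⟩)) exit (fun l => hm (some ⟨_, l⟩)) _
    exact ⟨v', add_comm 1 t ▸ (Steps.one (hm none)).trans hv⟩
  | seq _ _ ih₁ ih₂ =>
    intro Λ m e exit hm v
    obtain ⟨v₁, hv₁⟩ := ih₁ m _ _ (fun l => hm (.inl l)) v
    obtain ⟨v₂, hv₂⟩ := ih₂ m _ _ (fun l => hm (.inr l)) v₁
    exact ⟨v₂, hv₁.trans hv₂⟩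
  | @loop_exit k ι hι cls f S hc =>
    intro Λ m e exit hm v
    refine ⟨exit, ?_⟩
    have h1 := Steps.one (v := v) (S := S) (hm none)
    simp only [Prog.code, TM2.stepAux, hc, Option.elim] at h1
    exact h1
  | @loop_step k ι hι cls f S S₁ S₂ t₁ t₂ i hc _ _ ih₁ ih₂ =>
    intro Λ m e exit hm v
    obtain ⟨v₁, hv₁⟩ := ih₁ m (fun l => e (some ⟨i, l⟩)) (e none) (fun l => hm (some ⟨i, l⟩))
      ((f i).enter (fun l => e (some ⟨i, l⟩)) (e none))
    obtain ⟨v₂, hv₂⟩ := ih₂ m e exit hm v₁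
    refine ⟨v₂, ?_⟩
    have h1 := Steps.one (v := v) (S := S) (hm none)
    simp only [Prog.code, TM2.stepAux, hc, Option.elim] at h1
    rw [add_comm]
    exact h1.trans (hv₁.trans hv₂)

/-- The machine running a program. -/
noncomputable def Prog.toFinTM2 [DecidableEq K] [Fintype K] (p : Prog K Γ) (k₀ k₁ : K)
    (hk : Fintype (Γ k₀)) : FinTM2 :=
  haveI := p.finite_lab
  { K := K
    k₀ := k₀
    k₁ := k₁
    Γ := Γ
    Λ := Option p.Lab
    main := p.enter some none
    ΛFin := Fintype.ofFinite _
    σ := Option p.Lab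
    initialState := none
    σFin := Fintype.ofFinite _
    m := fun l => l.elim (.load (fun _ => none) .halt) (p.code some none) }

/-- The stacks that are all empty except for `k`, which holds `s`. -/
def single [DecidableEq K] (k : K) (s : List (Γ k)) : ∀ k, List (Γ k) :=
  update (fun _ => []) k s

@[simp]
theorem single_self [DecidableEq K] (k : K) (s : List (Γ k)) : single k s k = s :=
  update_self k _ _

theorem single_of_ne [DecidableEq K] {k k' : K} (h : k' ≠ k) (s : List (Γ k)) :
    single k s k' = [] :=
  update_of_ne h _ _

theorem initList_eq (tm : FinTM2) (s : List (tm.Γ tm.k₀)) :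
    initList tm s = ⟨some tm.main, tm.initialState, single tm.k₀ s⟩ := by
  refine congrArg (TM2.Cfg.mk _ _) (funext fun k => ?_)
  by_cases h : k = tm.k₀
  · subst h
    exact (dif_pos rfl).trans (single_self _ s).symm
  · exact (dif_neg h).trans (single_of_ne h s).symm

theorem haltList_eq (tm : FinTM2) (s : List (tm.Γ tm.k₁)) :
    haltList tm s = ⟨none, tm.initialState, single tm.k₁ s⟩ := by
  refine congrArg (TM2.Cfg.mk _ _) (funext fun k => ?_)
  by_cases h : k = tm.k₁
  · subst h
    exact (dif_pos rfl).trans (single_self _ s).symm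
  · exact (dif_neg h).trans (single_of_ne h s).symm

/-- The extra step is taken at the label `none`, which resets the internal state as `haltList`
demands and halts. -/
theorem Exec.outputsInTime [DecidableEq K] [Fintype K] {p : Prog K Γ} {k₀ k₁ : K}
    (hk : Fintype (Γ k₀)) {s : List (Γ k₀)} {s' : List (Γ k₁)} {t T : ℕ}
    (h : Exec p (single k₀ s) (single k₁ s') t) (hT : t + 1 ≤ T) :
    Nonempty (TM2OutputsInTime (p.toFinTM2 k₀ k₁ hk) s (some s') T) := by
  obtain ⟨v, hv⟩ := h.steps (p.toFinTM2 k₀ k₁ hk).m some none (fun _ => rfl) none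
  refine ⟨⟨⟨t + 1, ?_⟩, hT⟩⟩
  have h2 := hv.trans (Steps.one (m := (p.toFinTM2 k₀ k₁ hk).m) (l := none) rfl)
  refine (congrArg (fun c => (flip bind (TM2.step (p.toFinTM2 k₀ k₁ hk).m))^[t + 1] (some c))
    (initList_eq (p.toFinTM2 k₀ k₁ hk) s)).trans ?_
  exact Eq.trans h2 (congrArg some (haltList_eq (p.toFinTM2 k₀ k₁ hk) s').symm)

end StackMachine

/-! ## Binary trees on stacks -/

theorem Polynomial.eval_le_eval_of_le_nat (P : Polynomial ℕ) {a b : ℕ} (h : a ≤ b) :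
    P.eval a ≤ P.eval b := by
  induction P using Polynomial.induction_on' with
  | add p q hp hq => simpa using Nat.add_le_add hp hq
  | monomial n c => simpa using Nat.mul_le_mul_left c (Nat.pow_le_pow_left h n)

/-- Binary trees. -/
inductive BinTree
  | nil : BinTree
  | node (a b : BinTree) : BinTree

namespace BinTree

/-- The prefix code of a binary tree. -/
def ser : BinTree → List Bool
  | nil => [false]
  | node a b => true :: (a.ser ++ b.ser)

/-- The length of the prefix code of a binary tree. -/
def size (x : BinTree) : ℕ := x.ser.length

@[simp] theorem size_nil : size nil = 1 := rfl

@[simp] theorem size_node (a b : BinTree) : size (node a b) = a.size + b.size + 1 := by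
  simp [size, ser]

end BinTree

namespace StackMachine

open Function BinTree

/-- The stacks used by programs on trees: the main stack `M`, a stack `R` for values put aside, and
work stacks. -/
inductive Reg
  | M | R | W | X | C
  deriving DecidableEq

instance : Fintype Reg :=
  ⟨{.M, .R, .W, .X, .C}, fun k => by cases k <;> simp⟩

/-- Programs on trees. -/
abbrev TProg := Prog Reg (fun _ => Bool)

/-- The contents of the stacks, given one by one. -/
def st (m r w x c : List Bool) : Reg → List Bool
  | .M => m
  | .R => r
  | .W => w
  | .X => x
  | .C => c

section st
variable (m r w x c l : List Bool)

@[simp] theorem update_st_M : update (st m r w x c) .M l = st l r w x c := by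
  funext k; cases k <;> rfl
@[simp] theorem update_st_R : update (st m r w x c) .R l = st m l w x c := by
  funext k; cases k <;> rfl
@[simp] theorem update_st_W : update (st m r w x c) .W l = st m r l x c := by
  funext k; cases k <;> rfl
@[simp] theorem update_st_X : update (st m r w x c) .X l = st m r w l c := by
  funext k; cases k <;> rfl
@[simp] theorem update_st_C : update (st m r w x c) .C l = st m r w x l := by
  funext k; cases k <;> rfl
@[simp] theorem st_M : st m r w x c .M = m := rfl
@[simp] theorem st_R : st m r w x c .R = r := rfl
@[simp] theorem st_W : st m r w x c .W = w := rfl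
@[simp] theorem st_X : st m r w x c .X = x := rfl
@[simp] theorem st_C : st m r w x c .C = c := rfl

end st

/-! ### Execution within a time bound -/

/-- `Runs p S S' T`: the program `p` leads from `S` to `S'` in at most `T` steps. -/
def Runs {K : Type} {Γ : K → Type} [DecidableEq K] (p : Prog K Γ) (S S' : ∀ k, List (Γ k))
    (T : ℕ) : Prop :=
  ∃ t ≤ T, Exec p S S' t

section Runs
variable {K : Type} {Γ : K → Type} [DecidableEq K] {S S₁ S₂ S₃ : ∀ k, List (Γ k)} {T T₁ T₂ : ℕ}

theorem Runs.mono {p : Prog K Γ} (h : Runs p S S₁ T₁) (hT : T₁ ≤ T₂) : Runs p S S₁ T₂ :=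
  let ⟨t, ht, e⟩ := h
  ⟨t, ht.trans hT, e⟩

theorem Runs.congr {p : Prog K Γ} (h : Runs p S S₁ T₁) (hS : S₁ = S₂) (hT : T₁ ≤ T₂) :
    Runs p S S₂ T₂ :=
  hS ▸ h.mono hT

theorem Runs.congr_left {p : Prog K Γ} (h : Runs p S S₂ T) (hS : S₁ = S) : Runs p S₁ S₂ T :=
  hS ▸ h

theorem Runs.skip : Runs (.skip : Prog K Γ) S S 0 := ⟨0, le_rfl, .skip S⟩

theorem Runs.push (k : K) (a : Γ k) : Runs (.push k a) S (update S k (a :: S k)) 1 :=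
  ⟨1, le_rfl, .push k a S⟩

theorem Runs.pop {k : K} {ι : Type} {hι : Fintype ι} {cls : Option (Γ k) → ι} {f : ι → Prog K Γ}
    (h : Runs (f (cls (S k).head?)) (update S k (S k).tail) S₁ T) :
    Runs (.pop k ι hι cls f) S S₁ (T + 1) :=
  let ⟨t, ht, e⟩ := h
  ⟨t + 1, Nat.succ_le_succ ht, .pop e⟩

theorem Runs.peek {k : K} {ι : Type} {hι : Fintype ι} {cls : Option (Γ k) → ι} {f : ι → Prog K Γ}
    (h : Runs (f (cls (S k).head?)) S S₁ T) : Runs (.peek k ι hι cls f) S S₁ (T + 1) :=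
  let ⟨t, ht, e⟩ := h
  ⟨t + 1, Nat.succ_le_succ ht, .peek e⟩

theorem Runs.seq {p q : Prog K Γ} (h₁ : Runs p S₁ S₂ T₁) (h₂ : Runs q S₂ S₃ T₂) :
    Runs (.seq p q) S₁ S₃ (T₁ + T₂) :=
  let ⟨t₁, ht₁, e₁⟩ := h₁
  let ⟨t₂, ht₂, e₂⟩ := h₂
  ⟨t₁ + t₂, Nat.add_le_add ht₁ ht₂, .seq e₁ e₂⟩

theorem Runs.loop_exit {k : K} {ι : Type} {hι : Fintype ι} {cls : Option (Γ k) → Option ι}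
    {f : ι → Prog K Γ} (h : cls (S k).head? = none) :
    Runs (.loop k ι hι cls f) S (update S k (S k).tail) 1 :=
  ⟨1, le_rfl, .loop_exit h⟩

theorem Runs.loop_step {k : K} {ι : Type} {hι : Fintype ι} {cls : Option (Γ k) → Option ι}
    {f : ι → Prog K Γ} {i : ι} (h : cls (S k).head? = some i)
    (h₁ : Runs (f i) (update S k (S k).tail) S₁ T₁)
    (h₂ : Runs (.loop k ι hι cls f) S₁ S₂ T₂) :
    Runs (.loop k ι hι cls f) S S₂ (T₁ + T₂ + 1) :=
  let ⟨t₁, ht₁, e₁⟩ := h₁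
  let ⟨t₂, ht₂, e₂⟩ := h₂
  ⟨t₁ + t₂ + 1, by omega, .loop_step h e₁ e₂⟩

/-- Run a program on every element of a stack, emptying it. -/
def drain (k : K) (hk : Fintype (Γ k)) (f : Γ k → Prog K Γ) : Prog K Γ :=
  .loop k (Γ k) hk (fun o => o) f

theorem Runs.drain_nil {k : K} {hk : Fintype (Γ k)} {f : Γ k → Prog K Γ} (h : S k = []) :
    Runs (drain k hk f) S S 1 :=
  (Runs.loop_exit (by simp [h])).congr (update_eq_self_iff.mpr (by simp [h])) le_rfl

theorem Runs.drain_cons {k : K} {hk : Fintype (Γ k)} {f : Γ k → Prog K Γ} {b : Γ k}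
    {l : List (Γ k)} (h : S k = b :: l) (h₁ : Runs (f b) (update S k l) S₁ T₁)
    (h₂ : Runs (drain k hk f) S₁ S₂ T₂) : Runs (drain k hk f) S S₂ (T₁ + T₂ + 1) :=
  Runs.loop_step (i := b) (by simp [h]) (by simpa [h] using h₁) h₂

end Runs

theorem runs_push (k : Reg) (b : Bool) (S : Reg → List Bool) :
    Runs (.push k b : TProg) S (update S k (b :: S k)) 1 :=
  Runs.push (Γ := fun _ => Bool) k b

/-- Empty the stack `a` onto the stack `b`. -/
def pour (a b : Reg) : TProg := drain a inferInstance fun i => .push b i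

theorem runs_pour (a b : Reg) (hab : a ≠ b) (S : Reg → List Bool) :
    Runs (pour a b) S (update (update S a []) b ((S a).reverse ++ S b)) (2 * (S a).length + 1) := by
  generalize hl : S a = l
  induction l generalizing S with
  | nil =>
    refine (Runs.drain_nil hl).congr ?_ (by simp)
    funext k
    by_cases h1 : k = b
    · subst h1; simp
    · by_cases h2 : k = a
      · subst h2; simp [h1, hl]
      · simp [h1, h2]
  | cons i l ih =>
    refine (Runs.drain_cons hl (runs_push b i _) (ih _ ?_)).congr ?_ (by simp; omega)
    · simp [hab]
    · funext k
      by_cases h1 : k = b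
      · subst h1; simp [hab.symm]
      · by_cases h2 : k = a
        · subst h2; simp [h1]
        · simp [h1, h2]

/-! ### Moving, copying and exchanging trees -/

/-- The loop of `scan`. -/
def scanLoop (a : Reg) : TProg :=
  -- The marks on `C` count the subtrees still to be read: a leaf uses up one mark, an inner node
  -- replaces one mark by two.
  .loop .C Unit inferInstance (fun o => o.map fun _ => ()) fun _ =>
    .pop a Bool inferInstance (fun o => o.getD false) fun b =>
      .seq (.push .W b) (if b then .seq (.push .C true) (.push .C true) else .skip)

/-- The five steps: popping the mark, popping the bit, pushing it on `W`, and at most two new marks.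
-/
theorem runs_scanLoop_step {a : Reg} (hW : a ≠ .W) (hC : a ≠ .C) {b : Bool}
    {S S' : Reg → List Bool} {s c : List Bool} {T : ℕ} (ha : S a = b :: s)
    (hc : S .C = true :: c)
    (h : Runs (scanLoop a) (update (update (update S a s) .C
      (if b then true :: true :: c else c)) .W (b :: S .W)) S' T) :
    Runs (scanLoop a) S S' (T + 5) := by
  have h1 : Runs (.seq (.push .W b)
      (if b then .seq (.push .C true) (.push .C true) else .skip) : TProg)
      (update (update S .C c) a s) (update (update (update S a s) .C
        (if b then true :: true :: c else c)) .W (b :: S .W)) 3 := by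
    cases b
    · refine ((runs_push .W false _).seq Runs.skip).congr ?_ (by simp)
      funext k
      by_cases h1 : k = .W
      · subst h1; simp [hW.symm]
      · by_cases h2 : k = .C
        · subst h2; simp [hC.symm]
        · by_cases h3 : k = a
          · subst h3; simp [h1, h2]
          · simp [h1, h2, h3]
    · refine ((runs_push .W true _).seq ((runs_push .C true _).seq (runs_push .C true _))).congr
        ?_ (by simp)
      funext k
      by_cases h1 : k = .W
      · subst h1; simp [hW.symm]
      · by_cases h2 : k = .C
        · subst h2; simp [hC.symm]
        · by_cases h3 : k = a
          · subst h3; simp [h1, h2]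
          · simp [h1, h2, h3]
  refine (Runs.loop_step (i := ()) (by simp [hc]) (Runs.pop (T := 3) ?_) h).mono (by omega)
  simpa [hC, hc, ha] using h1

/-- Reading a whole tree uses up exactly one mark. In continuation form, a run that starts after the
tree is extended backwards over it, so that at a node the two subtrees are simply chained. -/
theorem runs_scanLoop (a : Reg) (hW : a ≠ .W) (hC : a ≠ .C) (x : BinTree) :
    ∀ (S S' : Reg → List Bool) (s c : List Bool) (T : ℕ), S a = x.ser ++ s → S .C = true :: c →
      Runs (scanLoop a)
        (update (update (update S a s) .C c) .W (x.ser.reverse ++ S .W)) S' T →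
      Runs (scanLoop a) S S' (T + 5 * x.size) := by
  induction x with
  | nil => exact fun S S' s c T ha hc h => runs_scanLoop_step hW hC ha hc h
  | node x y ihx ihy =>
    intro S S' s c T ha hc h
    refine (runs_scanLoop_step hW hC (b := true) (s := x.ser ++ (y.ser ++ s))
      (by simp [ha, ser]) hc (ihx _ _ (y.ser ++ s) (true :: c) _ ?_ ?_
        (ihy _ _ s c T ?_ ?_ ?_))).mono (by simp; omega)
    · simp [hW, hC]
    · simp
    · simp [hW, hC]
    · simp
    · convert h using 1
      funext k
      by_cases h1 : k = .W
      · subst h1; simp [ser]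
      · by_cases h2 : k = .C
        · subst h2; simp
        · by_cases h3 : k = a
          · subst h3; simp [h1, h2]
          · simp [h1, h2, h3]

theorem runs_scanLoop_exit (a : Reg) (m r w x : List Bool) :
    Runs (scanLoop a) (st m r w x []) (st m r w x []) 1 :=
  (Runs.loop_exit rfl).congr (by simp) le_rfl

/-- Move the tree on top of the stack `a` to `W`, in reverse order. -/
def scan (a : Reg) : TProg := .seq (.push .C true) (scanLoop a)

theorem runs_scan_M (x : BinTree) (m r w x' : List Bool) :
    Runs (scan .M) (st (x.ser ++ m) r w x' []) (st m r (x.ser.reverse ++ w) x' [])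
      (5 * x.size + 2) := by
  refine ((runs_push .C true _).seq (runs_scanLoop .M (by simp) (by simp) x _ _ m [] 1 ?_ ?_
    ?_)).congr rfl (by omega)
  · simp
  · simp
  simpa using runs_scanLoop_exit _ _ _ _ _

theorem runs_scan_R (x : BinTree) (m r w x' : List Bool) :
    Runs (scan .R) (st m (x.ser ++ r) w x' []) (st m r (x.ser.reverse ++ w) x' [])
      (5 * x.size + 2) := by
  refine ((runs_push .C true _).seq (runs_scanLoop .R (by simp) (by simp) x _ _ r [] 1 ?_ ?_
    ?_)).congr rfl (by omega)
  · simp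
  · simp
  simpa using runs_scanLoop_exit _ _ _ _ _

/-- The state between two operations on trees: only the stacks `M` and `R` are in use. -/
def st₀ (m r : List Bool) : Reg → List Bool := st m r [] [] []

/-- Move a tree from `M` to `R`. -/
def toR : TProg := .seq (scan .M) (pour .W .R)

theorem runs_toR (x : BinTree) (m r : List Bool) :
    Runs toR (st₀ (x.ser ++ m) r) (st₀ m (x.ser ++ r)) (7 * x.size + 3) := by
  refine ((runs_scan_M x m r [] []).seq (runs_pour .W .R (by simp) _)).congr (by simp [st₀]) (by simp [size]; omega)

/-- Move a tree from `R` to `M`. -/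
def toM : TProg := .seq (scan .R) (pour .W .M)

theorem runs_toM (x : BinTree) (m r : List Bool) :
    Runs toM (st₀ m (x.ser ++ r)) (st₀ (x.ser ++ m) r) (7 * x.size + 3) := by
  refine ((runs_scan_R x m r [] []).seq (runs_pour .W .M (by simp) _)).congr (by simp [st₀]) (by simp [size]; omega)

/-- Remove a tree from `M`. -/
def drop : TProg := .seq (scan .M) (drain .W inferInstance fun _ => .skip)

theorem runs_drop (x : BinTree) (m r : List Bool) :
    Runs drop (st₀ (x.ser ++ m) r) (st₀ m r) (6 * x.size + 3) := by
  have key : ∀ w : List Bool, Runs (drain .W inferInstance fun _ => .skip : TProg)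
      (st m r w [] []) (st m r [] [] []) (w.length + 1) := by
    intro w
    induction w with
    | nil => exact Runs.drain_nil rfl
    | cons b w ih =>
      exact (Runs.drain_cons (l := w) rfl Runs.skip (by simpa using ih)).congr rfl (by simp)
  refine ((runs_scan_M x m r [] []).seq (key _)).congr (by simp [st₀]) (by simp [size]; omega)

/-- Duplicate the tree on top of `M`. -/
def dup : TProg :=
  .seq (scan .M) (.seq (drain .W inferInstance fun b => .seq (.push .M b) (.push .X b))
    (.seq (pour .X .W) (pour .W .M)))

theorem runs_dup (x : BinTree) (m r : List Bool) :
    Runs dup (st₀ (x.ser ++ m) r) (st₀ (x.ser ++ (x.ser ++ m)) r) (12 * x.size + 5) := by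
  have key : ∀ m x' w : List Bool, Runs
      (drain .W inferInstance fun b => .seq (.push .M b) (.push .X b) : TProg)
      (st m r w x' []) (st (w.reverse ++ m) r [] (w.reverse ++ x') []) (3 * w.length + 1) := by
    intro m x' w
    induction w generalizing m x' with
    | nil => exact Runs.drain_nil rfl
    | cons b w ih =>
      refine (Runs.drain_cons (l := w) rfl ((runs_push .M b _).seq (runs_push .X b _))
        (S₂ := st (w.reverse ++ (b :: m)) r [] (w.reverse ++ (b :: x')) [])
        (T₂ := 3 * w.length + 1) ?_).congr (by simp) (by simp; omega)
      simpa using ih (b :: m) (b :: x')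
  refine ((runs_scan_M x m r [] []).seq ((key _ _ _).seq ((runs_pour .X .W (by simp) _).seq
    (runs_pour .W .M (by simp) _)))).congr (by simp [st₀]) (by simp [size]; omega)

/-- Exchange the two topmost trees of `M`. -/
def swap : TProg :=
  .seq toR (.seq (scan .M) (.seq (pour .W .X) (.seq toM (.seq (pour .X .W) (pour .W .M)))))

/-- The middle of `swap`: the second tree waits on `X`, because `toM` itself works through `W`. -/
theorem runs_toM_aux (x : BinTree) (m r x' : List Bool) :
    Runs toM (st m (x.ser ++ r) [] x' []) (st (x.ser ++ m) r [] x' []) (7 * x.size + 3) := by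
  refine ((runs_scan_R x m r [] x').seq (runs_pour .W .M (by simp) _)).congr (by simp) (by simp [size]; omega)

theorem runs_swap (x y : BinTree) (m r : List Bool) :
    Runs swap (st₀ (x.ser ++ (y.ser ++ m)) r) (st₀ (y.ser ++ (x.ser ++ m)) r)
      (14 * x.size + 11 * y.size + 11) := by
  have h1 := runs_pour .W .X (by simp) (st m (x.ser ++ r) (y.ser.reverse ++ []) [] [])
  have h2 := runs_toM_aux x m r y.ser
  have h3 := runs_pour .X .W (by simp) (st (x.ser ++ m) r [] y.ser [])
  have h4 := runs_pour .W .M (by simp) (st (x.ser ++ m) r (y.ser.reverse ++ []) [] [])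
  simp only [update_st_W, update_st_X, update_st_M, st_W, st_X, st_M, List.append_nil,
    List.reverse_reverse, List.length_reverse] at h1 h2 h3 h4
  refine ((runs_toR x (y.ser ++ m) r).seq ((runs_scan_M y m (x.ser ++ r) [] []).seq
    (Runs.seq ?_ (h2.seq (h3.seq h4))))).mono (T₁ := 7 * x.size + 3 + (5 * y.size + 2 +
      ((2 * y.size + 1) + (7 * x.size + 3 + (2 * y.size + 1 + (2 * y.size + 1)))))) (by omega)
  simpa [size] using h1

end StackMachine

/-! ## Polynomial-time functions on encodable types -/

namespace StackMachine

open Function BinTree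

/-- An encoding of a type by binary trees. -/
class Enc (α : Type) where
  /-- the encoding -/
  enc : α → BinTree

open Enc (enc)

/-- The encodings share their shapes on purpose: `false`, `[]`, `none` and `0` are all `nil`, while
`true`, cons, `some` and successor are nodes like a pair. Constructors then cost nothing
(`PolyTime.retype`), and one program (`PolyTime.cases`) handles every case distinction. -/
instance : Enc Unit := ⟨fun _ => .nil⟩

instance : Enc Bool := ⟨fun b => cond b (.node .nil .nil) .nil⟩

instance {α β : Type} [Enc α] [Enc β] : Enc (α × β) := ⟨fun p => .node (enc p.1) (enc p.2)⟩

/-- The encoding of lists. -/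
def encList {α : Type} [Enc α] : List α → BinTree
  | [] => .nil
  | a :: l => .node (enc a) (encList l)

instance {α : Type} [Enc α] : Enc (List α) := ⟨encList⟩

instance {α : Type} [Enc α] : Enc (Option α) := ⟨fun o => o.elim .nil fun a => .node (enc a) .nil⟩

/-- Natural numbers are encoded in unary. -/
instance : Enc ℕ := ⟨fun n => enc (List.replicate n ())⟩

section enc
variable {α β : Type} [Enc α] [Enc β]

@[simp] theorem enc_false : enc false = .nil := rfl
@[simp] theorem enc_true : enc true = .node .nil .nil := rfl
@[simp] theorem enc_prod (a : α) (b : β) : enc (a, b) = .node (enc a) (enc b) := rfl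
@[simp] theorem enc_nil : enc ([] : List α) = .nil := rfl
@[simp] theorem enc_cons (a : α) (l : List α) : enc (a :: l) = .node (enc a) (enc l) := rfl
@[simp] theorem enc_some (a : α) : enc (some a) = .node (enc a) .nil := rfl
@[simp] theorem enc_succ (n : ℕ) : enc (n + 1) = .node .nil (enc n) := rfl

end enc

/-- The size of the encoding. -/
def esize {α : Type} [Enc α] (a : α) : ℕ := (enc a).size

/-- The prefix code of the encoding. -/
def code {α : Type} [Enc α] (a : α) : List Bool := (enc a).ser

section esize
variable {α β : Type} [Enc α] [Enc β]

@[simp] theorem esize_prod (a : α) (b : β) : esize (a, b) = esize a + esize b + 1 := by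
  simp [esize]
@[simp] theorem esize_nil : esize ([] : List α) = 1 := rfl
@[simp] theorem esize_cons (a : α) (l : List α) : esize (a :: l) = esize a + esize l + 1 := by
  simp [esize]
@[simp] theorem esize_none : esize (none : Option α) = 1 := rfl
@[simp] theorem esize_succ (n : ℕ) : esize (n + 1) = esize n + 2 := by simp [esize]; omega

theorem esize_bool_le (b : Bool) : esize b ≤ 3 := by cases b <;> simp [esize]

theorem esize_pos (a : α) : 1 ≤ esize a := by
  unfold esize
  cases enc a <;> simp

theorem length_code (a : α) : (code a).length = esize a := rfl

theorem length_le_esize (l : List α) : l.length ≤ esize l := by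
  induction l with
  | nil => simp
  | cons a l ih => simp; omega

theorem esize_le_of_mem {a : α} {l : List α} (h : a ∈ l) : esize a ≤ esize l := by
  induction l with
  | nil => simp at h
  | cons b l ih =>
    rcases List.mem_cons.mp h with rfl | h
    · simp; omega
    · have := ih h
      simp; omega

theorem esize_nat (n : ℕ) : esize n = 2 * n + 1 := by
  induction n with
  | zero => rfl
  | succ n ih => simp [ih]; omega

theorem code_prod (a : α) (b : β) : code (a, b) = true :: (code a ++ code b) := rfl

theorem code_cons (a : α) (l : List α) : code (a :: l) = true :: (code a ++ code l) := rfl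

end esize

/-! ### Polynomial-time functions: composition, pairing, cases, folds -/

/-- `f` is computed in polynomial time by a program on trees. -/
def PolyTime {α β : Type} [Enc α] [Enc β] (f : α → β) : Prop :=
  ∃ (p : TProg) (P : Polynomial ℕ), ∀ a m r,
    Runs p (st₀ (code a ++ m) r) (st₀ (code (f a) ++ m) r) (P.eval (esize a))

/-- Pop a bit from `M` and branch. -/
def popM (f : Bool → TProg) : TProg := .pop .M Bool inferInstance (fun o => o.getD false) f

theorem runs_popM {f : Bool → TProg} {b : Bool} {m r : List Bool} {S : Reg → List Bool} {T : ℕ}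
    (h : Runs (f b) (st₀ m r) S T) : Runs (popM f) (st₀ (b :: m) r) S (T + 1) :=
  Runs.pop (by simpa [st₀] using h)

theorem runs_pushM (b : Bool) (m r : List Bool) :
    Runs (.push .M b : TProg) (st₀ m r) (st₀ (b :: m) r) 1 :=
  (runs_push .M b _).congr (by simp [st₀]) le_rfl

section basic
variable {α β γ δ σ τ : Type} [Enc α] [Enc β] [Enc γ] [Enc δ] [Enc σ] [Enc τ]

theorem runs_toR' (a : α) (m r : List Bool) :
    Runs toR (st₀ (code a ++ m) r) (st₀ m (code a ++ r)) (7 * esize a + 3) :=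
  runs_toR _ m r

theorem runs_toM' (a : α) (m r : List Bool) :
    Runs toM (st₀ m (code a ++ r)) (st₀ (code a ++ m) r) (7 * esize a + 3) :=
  runs_toM _ m r

theorem runs_drop' (a : α) (m r : List Bool) :
    Runs drop (st₀ (code a ++ m) r) (st₀ m r) (6 * esize a + 3) :=
  runs_drop _ m r

theorem runs_dup' (a : α) (m r : List Bool) :
    Runs dup (st₀ (code a ++ m) r) (st₀ (code a ++ (code a ++ m)) r) (12 * esize a + 5) :=
  runs_dup _ m r

theorem runs_swap' (a : α) (b : β) (m r : List Bool) :
    Runs swap (st₀ (code a ++ (code b ++ m)) r) (st₀ (code b ++ (code a ++ m)) r)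
      (14 * esize a + 11 * esize b + 11) :=
  runs_swap _ _ m r

namespace PolyTime

/-- The output is no longer than the input plus the running time. This is what makes composition
polynomial. -/
theorem esize_le {f : α → β} (hf : PolyTime f) :
    ∃ P : Polynomial ℕ, ∀ a, esize (f a) ≤ P.eval (esize a) := by
  obtain ⟨p, P, h⟩ := hf
  refine ⟨Polynomial.X + P, fun a => ?_⟩
  obtain ⟨t, ht, e⟩ := h a [] []
  have := e.length_le .M
  simp only [st₀, st_M, List.append_nil, length_code] at this
  simp; omega

theorem retype (f : α → β) (h : ∀ a, enc (f a) = enc a) : PolyTime f :=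
  ⟨.skip, 0, fun a m r => by
    have h' : code (f a) = code a := congrArg ser (h a)
    rw [h']
    exact Runs.skip.mono (Nat.zero_le _)⟩

theorem id : PolyTime (fun a : α => a) := retype _ fun _ => rfl

theorem comp {g : β → γ} {f : α → β} (hg : PolyTime g) (hf : PolyTime f) :
    PolyTime fun a => g (f a) := by
  obtain ⟨P', hP'⟩ := hf.esize_le
  obtain ⟨p, P, hf⟩ := hf
  obtain ⟨q, Q, hg⟩ := hg
  refine ⟨.seq p q, P + Q.comp P', fun a m r => ?_⟩
  refine ((hf a m r).seq (hg (f a) m r)).mono ?_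
  simpa using Q.eval_le_eval_of_le_nat (hP' a)

theorem pair {f : α → β} {g : α → γ} (hf : PolyTime f) (hg : PolyTime g) :
    PolyTime fun a => (f a, g a) := by
  obtain ⟨P', hP'⟩ := hf.esize_le
  obtain ⟨Q', hQ'⟩ := hg.esize_le
  obtain ⟨p, P, hf⟩ := hf
  obtain ⟨q, Q, hg⟩ := hg
  refine ⟨.seq dup (.seq p (.seq swap (.seq q (.seq swap (.push .M true))))),
    P + Q + 25 * P' + 23 * Polynomial.X + 14 * Q' + 28, fun a m r => ?_⟩
  refine ((runs_dup' a m r).seq ((hf a _ r).seq ((runs_swap' (f a) a m r).seq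
    ((hg a _ r).seq ((runs_swap' (g a) (f a) m r).seq (runs_pushM true _ r)))))).congr ?_ ?_
  · simp [code_prod]
  · have := hP' a
    have := hQ' a
    simp only [Polynomial.eval_add, Polynomial.eval_mul, Polynomial.eval_X, Polynomial.eval_ofNat]
    omega

/-- The program pushing a word on `M`. -/
def _root_.StackMachine.pushAll : List Bool → TProg
  | [] => .skip
  | b :: l => .seq (pushAll l) (.push .M b)

theorem _root_.StackMachine.runs_pushAll (l m r : List Bool) :
    Runs (pushAll l) (st₀ m r) (st₀ (l ++ m) r) l.length := by
  induction l with
  | nil => exact Runs.skip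
  | cons b l ih => exact ih.seq (runs_pushM b _ r)

theorem const (b : β) : PolyTime fun _ : α => b := by
  refine ⟨.seq drop (pushAll (StackMachine.code b)), 6 * Polynomial.X + 3 + Polynomial.C (esize b),
    fun a m r => ?_⟩
  refine ((runs_drop' a m r).seq (runs_pushAll _ m r)).mono ?_
  simp [length_code]

theorem fst : PolyTime fun p : α × β => p.1 := by
  refine ⟨popM fun _ => .seq swap drop, 20 * Polynomial.X + 15, fun p m r => ?_⟩
  obtain ⟨a, b⟩ := p
  rw [code_prod, List.cons_append, List.append_assoc]
  refine (runs_popM ?_ (T := 14 * esize a + 11 * esize b + 11 + (6 * esize b + 3))).mono ?_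
  · exact (runs_swap' a b m r).seq (runs_drop' b _ r)
  · simp; omega

theorem snd : PolyTime fun p : α × β => p.2 := by
  refine ⟨popM fun _ => drop, 6 * Polynomial.X + 4, fun p m r => ?_⟩
  obtain ⟨a, b⟩ := p
  rw [code_prod, List.cons_append, List.append_assoc]
  refine (runs_popM ?_ (T := 6 * esize a + 3)).mono ?_
  · exact runs_drop' a _ r
  · simp; omega

/-- The value `t a` is computed in front of a copy of `a`; then the bit of the pair and the root bit
of `t a` are popped. After `nil`, exactly the code of `a` is left. After a node, the codes of its
two children are left; a `true` in front turns them into the code of `(x, y)`, and a swap and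
another `true` give the code of `(a, x, y)`. -/
theorem cases {t : α → τ} {f : α → γ} {g : α × β × δ → γ} {h : α → γ} (ht : PolyTime t)
    (hf : PolyTime f) (hg : PolyTime g)
    (H : ∀ a, (enc (t a) = .nil ∧ h a = f a) ∨
      ∃ x y, enc (t a) = .node (enc x) (enc y) ∧ h a = g (a, x, y)) : PolyTime h := by
  obtain ⟨P', hP'⟩ := ht.esize_le
  obtain ⟨u, U, hu⟩ := ht.pair PolyTime.id
  obtain ⟨p, P, hf⟩ := hf
  obtain ⟨q, Q, hg⟩ := hg
  refine ⟨.seq u (popM fun _ => popM fun b =>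
    if b then .seq (.push .M true) (.seq swap (.seq (.push .M true) q)) else p),
    U + P + 14 * P' + 11 * Polynomial.X + 15 + 15 + Q.comp (Polynomial.X + P' + 1),
    fun a m r => ?_⟩
  have hu := hu a m r
  rw [code_prod, show StackMachine.code (t a) = (enc (t a)).ser from rfl] at hu
  have hs : (enc (t a)).size ≤ P'.eval (esize a) := hP' a
  rcases H a with ⟨h1, h2⟩ | ⟨x, y, h1, h2⟩
  · rw [h1] at hu
    refine (hu.seq (runs_popM (runs_popM (T := P.eval (esize a)) ?_))).mono ?_
    · simpa [h2] using hf a m r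
    · simp; omega
  · rw [h1] at hu hs
    have e1 : StackMachine.code (x, y) = true :: ((enc x).ser ++ (enc y).ser) := rfl
    have h3 := runs_pushM true ((enc x).ser ++ ((enc y).ser ++ (StackMachine.code a ++ m))) r
    have h4 := runs_swap' (x, y) a m r
    have h5 := runs_pushM true (StackMachine.code a ++ (StackMachine.code (x, y) ++ m)) r
    have h6 := hg (a, x, y) m r
    have h7 := h3.seq (Runs.seq (by simpa [e1] using h4) (h5.seq (by
      simpa [code_prod] using h6)))
    refine (hu.seq (runs_popM (runs_popM (S := st₀ (StackMachine.code (h a) ++ m) r)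
      (T := _) ?_))).mono (T₁ := U.eval (esize a) + (1 + ((14 * esize (x, y) + 11 * esize a + 11) +
        (1 + Q.eval (esize (a, x, y)))) + 1 + 1)) ?_
    · simpa [h2, ser] using h7
    · simp only [size_node] at hs
      have h8 := Q.eval_le_eval_of_le_nat
        (show esize (a, x, y) ≤ esize a + P'.eval (esize a) + 1 by simp [esize] at *; omega)
      have h9 : esize (x, y) ≤ P'.eval (esize a) := by simp [esize] at *; omega
      simp only [Polynomial.eval_add, Polynomial.eval_mul, Polynomial.eval_X,
        Polynomial.eval_ofNat, Polynomial.eval_comp, Polynomial.eval_one]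
      omega

/-- The list stays on `M` and the state on `R`. Popping the cons bit exposes `b`; the state is
fetched on top of it, and a `true` in front makes the pair `(s, b)`. With `N` bounding the list and
all intermediate states, `K` bounds the cost of one round. -/
theorem foldl_runs {step : σ × β → σ} {p : TProg} {P : Polynomial ℕ}
    (hp : ∀ a m r, Runs p (st₀ (StackMachine.code a ++ m) r)
      (st₀ (StackMachine.code (step a) ++ m) r) (P.eval (esize a)))
    (N K : ℕ) (hK : 14 * N + 9 + P.eval (2 * N + 1) ≤ K) (l : List β) :
    ∀ (s : σ), esize l ≤ N → (∀ l₁, l₁ <+: l → esize (l₁.foldl (fun s b => step (s, b)) s) ≤ N) →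
      ∀ m r, Runs (.loop .M Unit inferInstance (fun o => if o = some true then some () else none)
        fun _ => .seq toM (.seq (.push .M true) (.seq p toR)) : TProg)
        (st₀ (StackMachine.code l ++ m) (StackMachine.code s ++ r))
        (st₀ m (StackMachine.code (l.foldl (fun s b => step (s, b)) s) ++ r))
        (l.length * K + 1) := by
  induction l with
  | nil =>
    intro s _ _ m r
    refine (Runs.loop_exit (by simp [st₀, StackMachine.code, ser])).congr ?_ (by simp)
    simp [st₀, StackMachine.code, ser]
  | cons b l ih =>
    intro s hl hs m r
    have h0 : esize s ≤ N := hs [] (List.nil_prefix)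
    have h1 : esize (step (s, b)) ≤ N := hs [b] (by simp)
    simp only [esize_cons] at hl
    have h2 := ih (step (s, b)) (by omega) (fun l₁ h => hs (b :: l₁) (by simpa using h)) m r
    have h3 := runs_toM' s (StackMachine.code b ++ (StackMachine.code l ++ m)) r
    have h4 := runs_pushM true
      (StackMachine.code s ++ (StackMachine.code b ++ (StackMachine.code l ++ m))) r
    have h5 := hp (s, b) (StackMachine.code l ++ m) r
    have h6 := runs_toR' (step (s, b)) (StackMachine.code l ++ m) r
    have h7 := h3.seq (h4.seq (Runs.seq (by simpa [code_prod] using h5) h6))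
    refine (Runs.loop_step (i := ()) (by simp [st₀, code_cons]) ?_ h2).mono
      (T₁ := (7 * esize s + 3) + (1 + (P.eval (esize (s, b)) + (7 * esize (step (s, b)) + 3))) +
        (l.length * K + 1) + 1) ?_
    · simpa [st₀, code_cons] using h7
    · have h8 := P.eval_le_eval_of_le_nat (show esize (s, b) ≤ 2 * N + 1 by simp; omega)
      simp only [List.length_cons, Nat.add_mul, Nat.one_mul]
      omega

/-- The bound `Q` on all intermediate states is essential: a polynomial-time step could double the
state in every round. -/
theorem foldl_of_state {init : α → σ} {l : α → List β} {step : σ × β → σ} (hi : PolyTime init)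
    (hl : PolyTime l) (hs : PolyTime step) (Q : Polynomial ℕ)
    (hQ : ∀ a l₁, l₁ <+: l a →
      esize (l₁.foldl (fun s b => step (s, b)) (init a)) ≤ Q.eval (esize a)) :
    PolyTime fun a => (l a).foldl (fun s b => step (s, b)) (init a) := by
  obtain ⟨L, hL⟩ := hl.esize_le
  obtain ⟨u, U, hu⟩ := hi.pair hl
  obtain ⟨p, P, hp⟩ := hs
  refine ⟨.seq u (popM fun _ => .seq toR (.seq (.loop .M Unit inferInstance
    (fun o => if o = some true then some () else none)
    fun _ => .seq toM (.seq (.push .M true) (.seq p toR))) toM)),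
    U + 14 * Q + 8 + L * (14 * (L + Q) + 9 + P.comp (2 * (L + Q) + 1)), fun a m r => ?_⟩
  have hs0 := hQ a [] List.nil_prefix
  have hs1 := hQ a _ (List.prefix_refl _)
  have h1 := hu a m r
  rw [code_prod] at h1
  have h2 := runs_toR' (init a) (StackMachine.code (l a) ++ m) r
  have h3 := foldl_runs hp (L.eval (esize a) + Q.eval (esize a)) _ le_rfl (l a) (init a)
    ((hL a).trans (Nat.le_add_right _ _)) (fun l₁ h => (hQ a l₁ h).trans (Nat.le_add_left _ _)) m r
  have h4 := runs_toM' ((l a).foldl (fun s b => step (s, b)) (init a)) m r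
  refine (h1.seq (runs_popM (T := _) (by simpa using h2.seq (h3.seq h4)))).mono ?_
  have h5 := Nat.mul_le_mul_right (14 * (L.eval (esize a) + Q.eval (esize a)) + 9 +
    P.eval (2 * (L.eval (esize a) + Q.eval (esize a)) + 1))
    ((length_le_esize (l a)).trans (hL a))
  simp only [List.foldl_nil] at hs0
  simp only [Polynomial.eval_add, Polynomial.eval_mul, Polynomial.eval_ofNat,
    Polynomial.eval_comp, Polynomial.eval_one]
  omega

end PolyTime

end basic

end StackMachine

/-! ## Running a polynomial-time function after a Turing machine -/

namespace StackMachine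

open Function BinTree

/-- The stacks of a machine, together with a stack for its label and internal state (`false`), an
output stack (`true`) and the stacks for tree programs. -/
abbrev ExtStack (K : Type) : Type := (K ⊕ Bool) ⊕ Reg

/-- The alphabets of the stacks `ExtStack K`. -/
abbrev ExtAlphabet {K : Type} (Γ : K → Type) (Λ σ Δ : Type) : ExtStack K → Type
  | .inl (.inl k) => Γ k
  | .inl (.inr false) => Λ × σ
  | .inl (.inr true) => Δ
  | .inr _ => Bool

section
variable {K : Type} {Γ : K → Type} {Λ σ Δ : Type}

/-- The contents of the stacks `ExtStack K`. -/
abbrev extStacks (S : ∀ k, List (Γ k)) (c : List (Λ × σ)) (o : List Δ) (T : Reg → List Bool) :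
    ∀ k, List (ExtAlphabet Γ Λ σ Δ k)
  | .inl (.inl k) => S k
  | .inl (.inr false) => c
  | .inl (.inr true) => o
  | .inr k => T k

theorem extStacks_nil : extStacks (fun k : K => ([] : List (Γ k))) ([] : List (Λ × σ))
    ([] : List Δ) (st₀ [] []) = fun _ => [] := by
  funext k'
  rcases k' with (k' | _ | _) | k'
  rotate_left 3
  · cases k' <;> rfl
  all_goals rfl

variable [DecidableEq K] (S : ∀ k, List (Γ k)) (c : List (Λ × σ)) (o : List Δ)
  (T : Reg → List Bool)

theorem update_extStacks_machine (k : K) (l : List (Γ k)) :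
    update (extStacks S c o T) (.inl (.inl k)) l = extStacks (update S k l) c o T := by
  funext k'
  rcases k' with (k' | _ | _) | k'
  · by_cases h : k' = k
    · subst h; simp [extStacks]
    · simp [extStacks, h]
  all_goals rfl

theorem update_extStacks_ctrl (l : List (Λ × σ)) :
    update (extStacks S c o T) (.inl (.inr false)) l = extStacks S l o T := by
  funext k'
  rcases k' with (k' | _ | _) | k' <;> rfl

theorem update_extStacks_out (l : List Δ) :
    update (extStacks S c o T) (.inl (.inr true)) l = extStacks S c l T := by
  funext k'
  rcases k' with (k' | _ | _) | k' <;> rfl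

theorem update_extStacks_reg (k : Reg) (l : List Bool) :
    update (extStacks S c o T) (.inr k) l = extStacks S c o (update T k l) := by
  funext k'
  rcases k' with (k' | _ | _) | k'
  rotate_left 3
  · by_cases h : k' = k
    · subst h; simp [extStacks]
    · simp [extStacks, h]
  all_goals rfl

/-- A tree program as a program on `ExtStack K`. -/
def lift : TProg → Prog (ExtStack K) (ExtAlphabet Γ Λ σ Δ)
  | .skip => .skip
  | .push k a => .push (.inr k) a
  | .pop k ι hι cls f => .pop (.inr k) ι hι cls fun i => lift (f i)
  | .peek k ι hι cls f => .peek (.inr k) ι hι cls fun i => lift (f i)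
  | .seq p q => .seq (lift p) (lift q)
  | .loop k ι hι cls f => .loop (.inr k) ι hι cls fun i => lift (f i)

variable {S c o T}

theorem Exec.lift {p : TProg} {T T' : Reg → List Bool} {t : ℕ} (h : Exec p T T' t) :
    Exec (lift p) (extStacks S c o T) (extStacks S c o T') t := by
  induction h with
  | skip => exact .skip _
  | push k a T => exact update_extStacks_reg S c o T k _ ▸ Exec.push (Γ := ExtAlphabet Γ Λ σ Δ) (.inr k) a _
  | pop _ ih => exact .pop (by rw [update_extStacks_reg]; exact ih)
  | peek _ ih => exact .peek ih
  | seq _ _ ih₁ ih₂ => exact .seq ih₁ ih₂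
  | @loop_exit k ι hι cls f T h =>
    exact update_extStacks_reg S c o T k _ ▸ Exec.loop_exit h
  | loop_step h _ _ ih₁ ih₂ => exact .loop_step h (by rw [update_extStacks_reg]; exact ih₁) ih₂

theorem Runs.lift {p : TProg} {T T' : Reg → List Bool} {t : ℕ} (h : Runs p T T' t) :
    Runs (lift p) (extStacks S c o T) (extStacks S c o T') t :=
  let ⟨t, ht, e⟩ := h
  ⟨t, ht, e.lift⟩

/-! ### Simulation of a machine by a structured program -/

/-- The program executing a statement of a machine. -/
def simStmt [Fintype σ] : TM2.Stmt Γ Λ σ → σ → Prog (ExtStack K) (ExtAlphabet Γ Λ σ Δ)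
  | .push k f q, v => .seq (.push (.inl (.inl k)) (f v)) (simStmt q v)
  | .peek k f q, v => .peek (.inl (.inl k)) σ inferInstance (fun o => f v o) fun v' => simStmt q v'
  | .pop k f q, v => .pop (.inl (.inl k)) σ inferInstance (fun o => f v o) fun v' => simStmt q v'
  | .load a q, v => simStmt q (a v)
  | .branch f q₁ q₂, v => cond (f v) (simStmt q₁ v) (simStmt q₂ v)
  | .goto l, v => .push (.inl (.inr false)) (l v, v)
  | .halt, _ => .skip

/-- A bound for the time that `simStmt` needs. -/
def stmtDepth : TM2.Stmt Γ Λ σ → ℕ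
  | .push _ _ q => stmtDepth q + 1
  | .peek _ _ q => stmtDepth q + 1
  | .pop _ _ q => stmtDepth q + 1
  | .load _ q => stmtDepth q
  | .branch _ q₁ q₂ => stmtDepth q₁ + stmtDepth q₂
  | .goto _ => 1
  | .halt => 0

/-- The contents of the stack holding the label and the internal state of a machine. -/
def ctrl (l : Option Λ) (v : σ) : List (Λ × σ) := l.elim [] fun l => [(l, v)]

/-- As `σ` is finite, the internal state is a parameter of the translation and the program branches
on it. It is stored, together with the next label, only at a `goto`. -/
theorem runs_simStmt [Fintype σ] (q : TM2.Stmt Γ Λ σ) :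
    ∀ (v : σ) (S : ∀ k, List (Γ k)), Runs (simStmt q v) (extStacks S [] o T)
      (extStacks (TM2.stepAux q v S).stk (ctrl (TM2.stepAux q v S).l (TM2.stepAux q v S).var) o T)
      (stmtDepth q) := by
  induction q with
  | push k f q ih =>
    intro v S
    refine ((Runs.push _ _).seq ?_).mono (Nat.add_comm 1 _).le
    rw [update_extStacks_machine]
    exact ih v _
  | peek k f q ih => exact fun v S => Runs.peek (ih _ S)
  | pop k f q ih =>
    intro v S
    refine Runs.pop ?_
    rw [update_extStacks_machine]
    exact ih _ _
  | load a q ih => exact fun v S => ih _ S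
  | branch f q₁ q₂ ih₁ ih₂ =>
    intro v S
    simp only [simStmt, TM2.stepAux, stmtDepth]
    cases f v
    · exact (ih₂ v S).mono (Nat.le_add_left _ _)
    · exact (ih₁ v S).mono (Nat.le_add_right _ _)
  | goto l => exact fun v S => (Runs.push _ _).congr (update_extStacks_ctrl _ _ _ _ _) le_rfl
  | halt => exact fun v S => Runs.skip

/-- The control stack holds one pair while the machine runs and is empty once it has halted, so
draining it is the main loop of the simulation. -/
theorem runs_simulate [Fintype σ] [Fintype Λ] (m : Λ → TM2.Stmt Γ Λ σ) (D : ℕ)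
    (hD : ∀ l, stmtDepth (m l) ≤ D) (n : ℕ) :
    ∀ (l : Option Λ) (v v' : σ) (S S' : ∀ k, List (Γ k)),
      Steps m n ⟨l, v, S⟩ ⟨none, v', S'⟩ →
      Runs (drain (.inl (.inr false)) (inferInstanceAs (Fintype (Λ × σ)))
        fun (a : Λ × σ) => simStmt (m a.1) a.2)
        (extStacks S (ctrl l v) o T) (extStacks S' [] o T) (n * (D + 1) + 1) := by
  induction n with
  | zero =>
    intro l v v' S S' h
    obtain ⟨rfl, rfl, rfl⟩ : l = none ∧ v = v' ∧ S = S' := by simpa [Steps] using h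
    exact (Runs.drain_nil rfl).mono (by simp)
  | succ n ih =>
    intro l v v' S S' h
    cases l with
    | none =>
      exfalso
      have key : ∀ n, (flip bind (TM2.step m))^[n] none = none := by
        intro n
        induction n with
        | zero => rfl
        | succ n ih => exact ih
      have h' : (flip bind (TM2.step m))^[n] none = some _ := h
      rw [key] at h'
      cases h'
    | some l =>
      have h' := ih (TM2.stepAux (m l) v S).l (TM2.stepAux (m l) v S).var v'
        (TM2.stepAux (m l) v S).stk S' h
      refine (Runs.drain_cons (b := (l, v)) (l := []) rfl ?_ h').mono
        (T₁ := D + (n * (D + 1) + 1) + 1) (by rw [Nat.succ_mul]; omega)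
      rw [update_extStacks_ctrl]
      exact (runs_simStmt (m l) v S).mono (hD l)

/-! ### Transfer between machine stacks and tree codes -/

/-- Turn the contents of a stack into a list on `M`, in reverse order. -/
def readInput {I : Type} [Enc I] (k : K) (hk : Fintype (Γ k)) (ψ : Γ k → I) :
    Prog (ExtStack K) (ExtAlphabet Γ Λ σ Δ) :=
  .seq (lift (.push .M false)) (drain (.inl (.inl k)) hk fun a => lift (pushAll (true :: code (ψ a))))

theorem runs_readInput {I : Type} [Enc I] (k : K) (hk : Fintype (Γ k)) (ψ : Γ k → I) (D : ℕ)
    (hD : ∀ a, esize (ψ a) ≤ D) :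
    Runs (readInput k hk ψ) (extStacks S c o (st₀ [] []))
      (extStacks (update S k []) c o (st₀ (code ((S k).map ψ).reverse) []))
      ((S k).length * (D + 2) + 2) := by
  have key : ∀ (l : List (Γ k)) (l' : List I) (S : ∀ k, List (Γ k)), S k = l →
      Runs (drain (.inl (.inl k)) hk fun a : Γ k => lift (pushAll (true :: code (ψ a))))
        (extStacks S c o (st₀ (code l') []))
        (extStacks (update S k []) c o (st₀ (code ((l.map ψ).reverse ++ l')) []))
        (l.length * (D + 2) + 1) := by
    intro l
    induction l with
    | nil =>
      intro l' S hS
      refine (Runs.drain_nil (k := Sum.inl (Sum.inl k)) (S := extStacks S c o (st₀ (code l') [])) hS).congr ?_ (Nat.le_add_left _ _)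
      congr 1
      rw [update_eq_self_iff.mpr hS.symm]
    | cons a l ih =>
      intro l' S hS
      have h1 := ih (ψ a :: l') (update S k l) (update_self k l S)
      have h2 := (runs_pushAll (true :: code (ψ a)) (code l') []).lift (S := update S k l) (c := c)
        (o := o) (Λ := Λ) (σ := σ) (Δ := Δ)
      refine (Runs.drain_cons (b := a) (l := l) hS (T₁ := D + 1) ?_ (S₁ := extStacks (update S k l)
        c o (st₀ (code (ψ a :: l')) [])) ?_).mono (T₁ := D + 1 + (l.length * (D + 2) + 1) + 1) ?_
      · rw [update_extStacks_machine]
        exact h2.mono (by have := hD a; simpa [length_code] using this)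
      · simpa using h1
      · simp only [List.length_cons, Nat.succ_mul]; omega
  have h := (runs_pushM false [] []).lift (S := S) (c := c)
        (o := o) (Λ := Λ) (σ := σ) (Δ := Δ)
  refine (h.seq (key (S k) [] S rfl)).congr ?_ (by omega)
  simp

/-- Pop a bit from `M` and branch. -/
def popExt (f : Bool → Prog (ExtStack K) (ExtAlphabet Γ Λ σ Δ)) :
    Prog (ExtStack K) (ExtAlphabet Γ Λ σ Δ) :=
  .pop (.inr .M) Bool inferInstance (fun o : Option Bool => o.getD false) f

theorem runs_popExt {f : Bool → Prog (ExtStack K) (ExtAlphabet Γ Λ σ Δ)} {b : Bool}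
    {m r : List Bool} {S' : ∀ k, List (ExtAlphabet Γ Λ σ Δ k)} {t : ℕ}
    (h : Runs (f b) (extStacks S c o (st₀ m r)) S' t) :
    Runs (popExt f) (extStacks S c o (st₀ (b :: m) r)) S' (t + 1) :=
  Runs.pop (by rw [update_extStacks_reg]; simpa [st₀, extStacks] using h)

/-- Move a list from `M` to the output stack, in reverse order. -/
def writeOutput (φ : Option Bool → Δ) : Prog (ExtStack K) (ExtAlphabet Γ Λ σ Δ) :=
  .loop (.inr .M) Unit inferInstance
    (fun o : Option Bool => if o = some true then some () else none) fun _ =>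
    -- The codes are `0` for `none`, `100` for `some false` and `11000` for `some true`: the first
    -- two bits decide, the others are discarded.
    popExt fun b₁ => if b₁ then
      popExt fun b₂ => if b₂ then
        popExt fun _ => popExt fun _ => popExt fun _ => .push (.inl (.inr true)) (φ (some true))
      else popExt fun _ => .push (.inl (.inr true)) (φ (some false))
    else .push (.inl (.inr true)) (φ none)

theorem runs_writeOutput (φ : Option Bool → Δ) (l : List (Option Bool)) :
    Runs (writeOutput φ) (extStacks S c o (st₀ (code l) []))
      (extStacks S c ((l.map φ).reverse ++ o) (st₀ [] [])) (l.length * 7 + 1) := by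
  induction l generalizing o with
  | nil =>
    refine (Runs.loop_exit (by rfl)).congr ?_ (by simp)
    rw [update_extStacks_reg]
    simp [st₀, extStacks, code, ser]
  | cons a l ih =>
    have hpush : ∀ x : Δ, Runs (Γ := ExtAlphabet Γ Λ σ Δ) (.push (.inl (.inr true)) x)
        (extStacks S c o (st₀ (code l) [])) (extStacks S c (x :: o) (st₀ (code l) [])) 1 :=
      fun x => (Runs.push _ _).congr (update_extStacks_out _ _ _ _ _) le_rfl
    refine (Runs.loop_step (i := ()) (by rfl) (T₁ := 6)
      (S₁ := extStacks S c (φ a :: o) (st₀ (code l) [])) ?_ (ih (o := φ a :: o))).congr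
        (by simp) (by simp; omega)
    have e : update (extStacks (Λ := Λ) (σ := σ) S c o (st₀ (code (a :: l)) [])) (.inr .M)
        (code a ++ code l) = extStacks S c o (st₀ (code a ++ code l) []) := by
      rw [update_extStacks_reg]; simp [st₀]
    refine Eq.mpr (congrArg (fun S => Runs _ S _ _) e) ?_
    rcases a with _ | _ | _
    · exact (runs_popExt (b := false) (hpush _)).mono (by omega)
    · exact (runs_popExt (b := true) (runs_popExt (b := false)
        (runs_popExt (b := false) (hpush _)))).mono (by omega)
    · exact (runs_popExt (b := true) (runs_popExt (b := true) (runs_popExt (b := false)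
        (runs_popExt (b := false) (runs_popExt (b := false) (hpush _)))))).mono (by omega)

end

theorem esize_list_le {I : Type} [Enc I] (D : ℕ) (l : List I) (hD : ∀ a ∈ l, esize a ≤ D) :
    esize l ≤ l.length * (D + 1) + 1 := by
  induction l with
  | nil => simp
  | cons a l ih =>
    have := hD a List.mem_cons_self
    have := ih fun b hb => hD b (List.mem_cons_of_mem _ hb)
    simp [Nat.succ_mul]; omega

/-- The new machine simulates the one for `f`, reads its output as a list of letters, applies `g`
and writes the result. Each of the two transfers pops one stack while building the other and so
reverses the order, which explains both `reverse` in `hc`. A reduction is obtained from the given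
machine for `f`, a verifier from the identity. -/
theorem computableInPolyTime_of_polyTime {A B C : Type} {Γ₀ Γ₁ Δ : Type} [Fintype Γ₁]
    {ea : A → List Γ₀} {eb : B → List Γ₁} {ec : C → List Δ} {f : A → B}
    (hf : TM2ComputableInPolyTime ea eb f) {I : Type} [Enc I] [Finite I] (ψ : Γ₁ → I)
    (φ : Option Bool → Δ) {g : List I → List (Option Bool)} (hg : PolyTime g) (h : A → C)
    (hc : ∀ a, ec (h a) = ((g ((eb (f a)).map ψ).reverse).map φ).reverse) :
    Nonempty (TM2ComputableInPolyTime ea ec h) := by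
  obtain ⟨⟨tm, α₀, α₁⟩, P, hP⟩ := hf
  have hP : ∀ a, ∃ n ≤ P.eval (ea a).length, Steps tm.m n
      ⟨some tm.main, tm.initialState, single tm.k₀ ((ea a).map α₀.invFun)⟩
      ⟨none, tm.initialState, single tm.k₁ ((eb (f a)).map α₁.invFun)⟩ := by
    intro a
    obtain ⟨⟨n, hn⟩, hn'⟩ := hP a
    refine ⟨n, hn', ?_⟩
    refine (congrArg (fun c => (flip bind (TM2.step tm.m))^[n] (some c))
      (initList_eq tm _)).symm.trans ?_
    exact hn.trans (congrArg some (haltList_eq tm _))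
  have := tm.ΛFin
  have := tm.σFin
  have := tm.kFin
  obtain ⟨D₁, hD₁⟩ := Finite.exists_le fun l => stmtDepth (tm.m l)
  obtain ⟨D₂, hD₂⟩ := Finite.exists_le fun i : I => esize i
  obtain ⟨G, hG⟩ := hg.esize_le
  obtain ⟨q, Q, hq⟩ := hg
  have hk : Fintype (tm.Γ tm.k₁) := Fintype.ofEquiv _ α₁.symm
  let p : Prog (ExtStack tm.K) (ExtAlphabet tm.Γ tm.Λ tm.σ Δ) :=
    .seq (.seq (.push (.inl (.inr false)) (tm.main, tm.initialState))
      (drain (.inl (.inr false)) (inferInstanceAs (Fintype (tm.Λ × tm.σ)))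
        fun a : tm.Λ × tm.σ => simStmt (tm.m a.1) a.2))
      ((.seq (readInput tm.k₁ hk fun a => ψ (α₁ a)) (.seq (lift q) (writeOutput φ))))
  -- `A` bounds the time of the simulation, hence `X + A` the length of its output; `L` bounds the
  -- time for reading this output and the size of the resulting argument of `g`.
  let A : Polynomial ℕ := P * Polynomial.C (D₁ + 1) + 2
  let L : Polynomial ℕ := (Polynomial.X + A) * Polynomial.C (D₂ + 2) + 2
  refine ⟨⟨⟨p.toFinTM2 (.inl (.inl tm.k₀)) (.inl (.inr true)) tm.Γk₀Fin, α₀, Equiv.refl Δ⟩,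
    A + L + Q.comp L + 7 * G.comp L + 2, fun a => Nonempty.some ?_⟩⟩
  obtain ⟨n, hn', hn⟩ := hP a
  set s : List (tm.Γ tm.k₀) := (ea a).map α₀.invFun with hs
  set s' : List (tm.Γ tm.k₁) := (eb (f a)).map α₁.invFun with hs'
  have hlen : s.length = (ea a).length := by simp [hs]
  have r₁ := (Runs.push (Γ := ExtAlphabet tm.Γ tm.Λ tm.σ Δ) (.inl (.inr false))
    (tm.main, tm.initialState) (S := extStacks (single tm.k₀ s) [] [] (st₀ [] []))).seq
    ((runs_simulate (o := ([] : List Δ)) (T := st₀ [] []) tm.m D₁ hD₁ n _ _ _ _ _ hn).congr_left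
      (update_extStacks_ctrl _ _ _ _ _))
  have hs'len : s'.length ≤ (Polynomial.X + A).eval (ea a).length := by
    obtain ⟨t, ht, e⟩ := r₁
    have h1 := e.length_le (.inl (.inl tm.k₁))
    have h2 : (single tm.k₀ s tm.k₁).length ≤ s.length := by
      by_cases h : tm.k₁ = tm.k₀
      · rw [h, single_self]
      · rw [single_of_ne h]; simp
    simp only [extStacks, single_self] at h1
    have h3 := Nat.mul_le_mul_right (D₁ + 1) hn'
    simp only [A, Polynomial.eval_add, Polynomial.eval_mul, Polynomial.eval_C, Polynomial.eval_X,
      Polynomial.eval_ofNat]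
    omega
  have r₂ := runs_readInput (c := ([] : List (tm.Λ × tm.σ))) (o := ([] : List Δ))
    (S := single tm.k₁ s') tm.k₁ hk (fun a => ψ (α₁ a)) D₂ fun a => hD₂ _
  rw [single_self] at r₂
  have e1 : update (single tm.k₁ s') tm.k₁ [] = fun _ => [] := by simp [single]
  have e2 : s'.map (fun a => ψ (α₁ a)) = (eb (f a)).map ψ := by
    simp [hs', Function.comp_def]
  rw [e1, e2] at r₂
  have r₃ := (hq ((eb (f a)).map ψ).reverse [] []).lift (S := fun k : tm.K => ([] : List (tm.Γ k)))
    (c := ([] : List (tm.Λ × tm.σ))) (o := ([] : List Δ))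
  rw [List.append_nil, List.append_nil] at r₃
  have r₄ := runs_writeOutput (S := fun k : tm.K => ([] : List (tm.Γ k)))
    (c := ([] : List (tm.Λ × tm.σ))) (o := ([] : List Δ)) φ (g ((eb (f a)).map ψ).reverse)
  rw [← hc, List.append_nil] at r₄
  obtain ⟨t, ht, e⟩ := r₁.seq (r₂.seq (r₃.seq r₄))
  have e3 : extStacks (single tm.k₀ s) [] [] (st₀ [] []) =
      single (Γ := ExtAlphabet tm.Γ tm.Λ tm.σ Δ) (.inl (.inl tm.k₀)) s := by
    rw [single, single, ← update_extStacks_machine, extStacks_nil]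
  have e4 : extStacks (fun k : tm.K => ([] : List (tm.Γ k))) [] (ec (h a)) (st₀ [] []) =
      single (Γ := ExtAlphabet tm.Γ tm.Λ tm.σ Δ) (.inl (.inr true)) (ec (h a)) := by
    rw [single, ← extStacks_nil, update_extStacks_out]
  rw [e3, e4] at e
  have h3 := Nat.mul_le_mul_right (D₁ + 1) hn'
  have h4 := Nat.mul_le_mul_right (D₂ + 2) hs'len
  have h5 : esize ((eb (f a)).map ψ).reverse ≤ L.eval (ea a).length := by
    have h6 := esize_list_le D₂ ((eb (f a)).map ψ).reverse fun a _ => hD₂ a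
    have h7 : ((eb (f a)).map ψ).reverse.length = s'.length := by simp [hs']
    rw [h7] at h6
    have h8 := Nat.mul_le_mul_left s'.length (show D₂ + 1 ≤ D₂ + 2 by omega)
    simp only [L, Polynomial.eval_add, Polynomial.eval_mul, Polynomial.eval_C, Polynomial.eval_X,
      Polynomial.eval_ofNat] at h4 ⊢
    omega
  have h6 := Q.eval_le_eval_of_le_nat h5
  have h7 := (length_le_esize _).trans ((hG _).trans (G.eval_le_eval_of_le_nat h5))
  have h8 : t + 1 ≤ (A + L + Q.comp L + 7 * G.comp L + 2).eval (ea a).length := by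
    have h9 : L.eval (ea a).length = (Polynomial.X + A).eval (ea a).length * (D₂ + 2) + 2 := by
      simp [L]
    have h10 : A.eval (ea a).length = P.eval (ea a).length * (D₁ + 1) + 2 := by simp [A]
    simp only [Polynomial.eval_add, Polynomial.eval_mul, Polynomial.eval_ofNat,
      Polynomial.eval_comp] at h4 h9 ⊢
    omega
  have h9 := Exec.outputsInTime (p := p) (k₀ := .inl (.inl tm.k₀)) (k₁ := .inl (.inr true))
    tm.Γk₀Fin e h8
  have e5 : (ec (h a)).map (Equiv.refl Δ).invFun = ec (h a) := List.map_id _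
  exact (congrArg (fun o => Nonempty (TM2OutputsInTime (p.toFinTM2 (.inl (.inl tm.k₀))
    (.inl (.inr true)) tm.Γk₀Fin) s (some o) _)) e5).mpr h9

end StackMachine

/-! ## Closure properties of polynomial-time functions -/

namespace StackMachine.PolyTime

variable {α β γ δ σ τ : Type} [Enc α] [Enc β] [Enc γ] [Enc δ] [Enc σ] [Enc τ]

theorem cons {f : α → β} {g : α → List β} (hf : PolyTime f) (hg : PolyTime g) :
    PolyTime fun a => f a :: g a :=
  (retype (fun p : β × List β => p.1 :: p.2) fun _ => rfl).comp (hf.pair hg)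

theorem succ {f : α → ℕ} (hf : PolyTime f) : PolyTime fun a => f a + 1 :=
  (retype (fun p : Unit × ℕ => p.2 + 1) fun _ => rfl).comp ((const ()).pair hf)

theorem some {f : α → β} (hf : PolyTime f) : PolyTime fun a => Option.some (f a) :=
  (retype (fun p : β × Unit => Option.some p.1) fun _ => rfl).comp (hf.pair (const ()))

theorem replicate {f : α → ℕ} (hf : PolyTime f) : PolyTime fun a => List.replicate (f a) () :=
  (retype (fun n : ℕ => List.replicate n ()) fun _ => rfl).comp hf

theorem cond {c : α → Bool} {f g : α → β} (hc : PolyTime c) (hf : PolyTime f) (hg : PolyTime g) :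
    PolyTime fun a => bif c a then f a else g a :=
  cases (β := Unit) (δ := Unit) hc hg (hf.comp fst) fun a => by
    cases h : c a
    · exact .inl ⟨rfl, by simp⟩
    · exact .inr ⟨(), (), rfl, by simp⟩

theorem and {c d : α → Bool} (hc : PolyTime c) (hd : PolyTime d) :
    PolyTime fun a => c a && d a := by
  convert hc.cond hd (const false) using 2 with a
  cases c a <;> rfl

theorem or {c d : α → Bool} (hc : PolyTime c) (hd : PolyTime d) :
    PolyTime fun a => c a || d a := by
  convert hc.cond (const true) hd using 2 with a
  cases c a <;> rfl

theorem not {c : α → Bool} (hc : PolyTime c) : PolyTime fun a => !c a := by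
  convert hc.cond (const false) (const true) using 2 with a
  cases c a <;> rfl

theorem xor {c d : α → Bool} (hc : PolyTime c) (hd : PolyTime d) :
    PolyTime fun a => Bool.xor (c a) (d a) := by
  convert hc.cond hd.not hd using 2 with a
  cases c a <;> cases d a <;> rfl

theorem listCases {l : α → List β} {f : α → γ} {g : α × β × List β → γ} {h : α → γ}
    (hl : PolyTime l) (hf : PolyTime f) (hg : PolyTime g) (h₁ : ∀ a, l a = [] → h a = f a)
    (h₂ : ∀ a b t, l a = b :: t → h a = g (a, b, t)) : PolyTime h :=
  cases hl hf hg fun a => by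
    rcases e : l a with _ | ⟨b, t⟩
    · exact .inl ⟨rfl, h₁ a e⟩
    · exact .inr ⟨b, t, rfl, h₂ a b t e⟩

theorem optionCases {l : α → Option β} {f : α → γ} {g : α × β → γ} {h : α → γ}
    (hl : PolyTime l) (hf : PolyTime f) (hg : PolyTime g) (h₁ : ∀ a, l a = none → h a = f a)
    (h₂ : ∀ a b, l a = Option.some b → h a = g (a, b)) : PolyTime h :=
  cases (g := fun p : α × β × Unit => g (p.1, p.2.1)) hl hf
    (hg.comp (fst.pair (fst.comp snd))) fun a => by
    rcases e : l a with _ | b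
    · exact .inl ⟨rfl, h₁ a e⟩
    · exact .inr ⟨b, (), rfl, h₂ a b e⟩

theorem natCases {l : α → ℕ} {f : α → γ} {g : α × ℕ → γ} {h : α → γ}
    (hl : PolyTime l) (hf : PolyTime f) (hg : PolyTime g) (h₁ : ∀ a, l a = 0 → h a = f a)
    (h₂ : ∀ a b, l a = b + 1 → h a = g (a, b)) : PolyTime h :=
  cases (g := fun p : α × Unit × ℕ => g (p.1, p.2.2)) hl hf
    (hg.comp (fst.pair (snd.comp snd))) fun a => by
    rcases e : l a with _ | b
    · exact .inl ⟨rfl, h₁ a e⟩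
    · exact .inr ⟨(), b, rfl, h₂ a b e⟩

theorem tail {l : α → List β} (hl : PolyTime l) : PolyTime fun a => (l a).tail :=
  listCases hl (const []) (snd.comp snd) (fun a h => by simp [h]) (fun a b t h => by simp [h])

theorem headD {l : α → List β} {d : α → β} (hl : PolyTime l) (hd : PolyTime d) :
    PolyTime fun a => (l a).headD (d a) :=
  listCases hl hd (fst.comp snd) (fun a h => by simp [h]) (fun a b t h => by simp [h])

/-- The input `a` is carried along in the state, so that the step may depend on it. -/
theorem foldl {init : α → σ} {l : α → List β} {step : α × σ × β → σ} (hi : PolyTime init)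
    (hl : PolyTime l) (hs : PolyTime step) (Q : Polynomial ℕ)
    (hQ : ∀ a l₁, l₁ <+: l a →
      esize (l₁.foldl (fun s b => step (a, s, b)) (init a)) ≤ Q.eval (esize a)) :
    PolyTime fun a => (l a).foldl (fun s b => step (a, s, b)) (init a) := by
  have key : ∀ a (l : List β) s, l.foldl (fun (s : α × σ) b => (s.1, step (s.1, s.2, b))) (a, s) =
      (a, l.foldl (fun s b => step (a, s, b)) s) := by
    intro a l
    induction l with
    | nil => intro s; rfl
    | cons b l ih => intro s; exact ih _
  have h := foldl_of_state (init := fun a => (a, init a)) (l := l)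
    (step := fun p : (α × σ) × β => (p.1.1, step (p.1.1, p.1.2, p.2))) (id.pair hi) hl
    ((fst.comp fst).pair (hs.comp ((fst.comp fst).pair ((snd.comp fst).pair snd))))
    (Polynomial.X + Q + 1) (fun a l₁ h => by
      rw [key]
      have := hQ a l₁ h
      simp; omega)
  simp only [key] at h
  exact snd.comp h

/-- Growth by a bounded amount per round adds up to a polynomial. A measure other than `esize` is
needed for sums of binary numbers: their lengths grow additively, while `esize` also depends on the
values of the bits. -/
theorem foldl_of_measure {init : α → σ} {l : α → List β} {step : α × σ × β → σ}
    (hi : PolyTime init) (hl : PolyTime l) (hs : PolyTime step) (μ : σ → ℕ) (c : ℕ)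
    (h₁ : ∀ s, μ s ≤ esize s) (h₂ : ∀ s, esize s ≤ c * μ s + c) (Q : Polynomial ℕ)
    (h₃ : ∀ a s b, b ∈ l a → μ (step (a, s, b)) ≤ μ s + Q.eval (esize a)) :
    PolyTime fun a => (l a).foldl (fun s b => step (a, s, b)) (init a) := by
  obtain ⟨I, hI⟩ := hi.esize_le
  obtain ⟨L, hL⟩ := hl.esize_le
  refine foldl hi hl hs (Polynomial.C c * (I + L * Q) + Polynomial.C c) fun a l₁ hl₁ => ?_
  have key : ∀ (l₂ : List β), (∀ b ∈ l₂, b ∈ l a) → ∀ s,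
      μ (l₂.foldl (fun s b => step (a, s, b)) s) ≤ μ s + l₂.length * Q.eval (esize a) := by
    intro l₂
    induction l₂ with
    | nil => simp
    | cons b l₂ ih =>
      intro h s
      have e1 := ih (fun b hb => h b (List.mem_cons_of_mem _ hb)) (step (a, s, b))
      have e2 := h₃ a s b (h b List.mem_cons_self)
      simp only [List.foldl_cons, List.length_cons, Nat.succ_mul]
      omega
  have e1 := key l₁ (fun b hb => hl₁.subset hb) (init a)
  have e2 := (h₁ (init a)).trans (hI a)
  have e3 : l₁.length ≤ L.eval (esize a) :=
    hl₁.length_le.trans ((length_le_esize _).trans (hL a))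
  refine (h₂ _).trans ?_
  simp only [Polynomial.eval_add, Polynomial.eval_mul, Polynomial.eval_C]
  gcongr
  refine e1.trans ?_
  gcongr

theorem foldl_of_growth {init : α → σ} {l : α → List β} {step : α × σ × β → σ}
    (hi : PolyTime init) (hl : PolyTime l) (hs : PolyTime step) (Q : Polynomial ℕ)
    (hQ : ∀ a s b, b ∈ l a → esize (step (a, s, b)) ≤ esize s + Q.eval (esize a)) :
    PolyTime fun a => (l a).foldl (fun s b => step (a, s, b)) (init a) :=
  foldl_of_measure hi hl hs esize 1 (fun _ => le_rfl) (fun _ => by omega) Q hQ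

theorem reverse {l : α → List β} (hl : PolyTime l) : PolyTime fun a => (l a).reverse := by
  obtain ⟨L, hL⟩ := hl.esize_le
  convert foldl_of_growth (init := fun _ => []) (step := fun p : α × List β × β => p.2.2 :: p.2.1)
    (const []) hl ((snd.comp snd).cons (fst.comp snd)) (L + 1) (fun a s b hb => ?_) using 2 with a
  · rw [List.foldl_flip_cons_eq_append', List.append_nil]
  · have := (esize_le_of_mem hb).trans (hL a)
    simp; omega

theorem map {l : α → List β} {f : α × β → γ} (hl : PolyTime l) (hf : PolyTime f) :
    PolyTime fun a => (l a).map fun b => f (a, b) := by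
  obtain ⟨L, hL⟩ := hl.esize_le
  obtain ⟨F, hF⟩ := hf.esize_le
  have h := (foldl_of_growth (init := fun _ => [])
    (step := fun p : α × List γ × β => f (p.1, p.2.2) :: p.2.1)
    (const []) hl ((hf.comp (fst.pair (snd.comp snd))).cons (fst.comp snd))
    (F.comp (Polynomial.X + L + 1) + 1) (fun a s b hb => ?_)).reverse
  · convert h using 2 with a
    have key : ∀ (l : List β) (s : List γ),
        l.foldl (fun s b => f (a, b) :: s) s = (l.map fun b => f (a, b)).reverse ++ s := by
      intro l
      induction l with
      | nil => simp
      | cons b l ih => intro s; simp [ih]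
    simp [key]
  · have e1 := (hF (a, b)).trans (F.eval_le_eval_of_le_nat (b := esize a + L.eval (esize a) + 1)
      (by have := (esize_le_of_mem hb).trans (hL a); simp; omega))
    simp; omega

theorem all {l : α → List β} {f : α × β → Bool} (hl : PolyTime l) (hf : PolyTime f) :
    PolyTime fun a => (l a).all fun b => f (a, b) := by
  convert foldl_of_growth (init := fun _ => true)
    (step := fun p : α × Bool × β => p.2.1 && f (p.1, p.2.2))
    (const true) hl ((fst.comp snd).and (hf.comp (fst.pair (snd.comp snd)))) 2
    (fun a s b hb => ?_) using 2 with a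
  · have key : ∀ (l : List β) (s : Bool),
        l.foldl (fun s b => s && f (a, b)) s = (s && l.all fun b => f (a, b)) := by
      intro l
      induction l with
      | nil => simp
      | cons b l ih => intro s; simp [ih, Bool.and_assoc]
    simp [key]
  · have e1 := esize_bool_le (s && f (a, b))
    have e2 := esize_pos s
    simp; omega

theorem any {l : α → List β} {f : α × β → Bool} (hl : PolyTime l) (hf : PolyTime f) :
    PolyTime fun a => (l a).any fun b => f (a, b) := by
  convert (hl.all hf.not).not using 2 with a
  rw [List.not_all_eq_any_not]
  simp

theorem append {l l' : α → List β} (hl : PolyTime l) (hl' : PolyTime l') :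
    PolyTime fun a => l a ++ l' a := by
  obtain ⟨L, hL⟩ := hl.esize_le
  convert foldl_of_growth (init := l') (l := fun a => (l a).reverse)
    (step := fun p : α × List β × β => p.2.2 :: p.2.1)
    hl' hl.reverse ((snd.comp snd).cons (fst.comp snd)) (L + 1) (fun a s b hb => ?_) using 2 with a
  · rw [List.foldl_flip_cons_eq_append', List.reverse_reverse]
  · have := (esize_le_of_mem (List.mem_reverse.mp hb)).trans (hL a)
    simp; omega

theorem length {l : α → List β} (hl : PolyTime l) : PolyTime fun a => (l a).length := by
  convert foldl_of_growth (init := fun _ => 0) (step := fun p : α × ℕ × β => p.2.1 + 1)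
    (const 0) hl (fst.comp snd).succ 2 (fun a s b hb => by simp) using 2 with a
  have key : ∀ (l : List β) (n : ℕ), l.foldl (fun s _ => s + 1) n = l.length + n := by
    intro l
    induction l with
    | nil => simp
    | cons b l ih => intro n; simp [ih]; omega
  simp [key]

theorem drop {n : α → ℕ} {l : α → List β} (hn : PolyTime n) (hl : PolyTime l) :
    PolyTime fun a => (l a).drop (n a) := by
  convert foldl_of_growth (init := l) (l := fun a => List.replicate (n a) ())
    (step := fun p : α × List β × Unit => p.2.1.tail)
    hl hn.replicate (fst.comp snd).tail 0 (fun a s b hb => ?_) using 2 with a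
  · have key : ∀ (n : ℕ) (s : List β),
        (List.replicate n ()).foldl (fun s _ => s.tail) s = s.drop n := by
      intro n
      induction n with
      | zero => simp
      | succ n ih => intro s; simp [List.replicate_succ, ih]
    simp [key]
  · cases s <;> simp; omega

theorem sub {n m : α → ℕ} (hn : PolyTime n) (hm : PolyTime m) :
    PolyTime fun a => n a - m a := by
  convert ((hm.drop hn.replicate).length) using 2 with a
  simp

theorem natBeq {n m : α → ℕ} (hn : PolyTime n) (hm : PolyTime m) :
    PolyTime fun a => n a == m a := by
  have h0 : ∀ {k : α → ℕ}, PolyTime k → PolyTime fun a => k a == 0 := fun hk =>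
    natCases hk (const true) (const false) (fun a h => by simp [h]) (fun a b h => by simp [h])
  convert (h0 (hn.sub hm)).and (h0 (hm.sub hn)) using 2 with a
  rw [Bool.eq_iff_iff]
  simp
  omega

/-- Each round enlarges the list by the size of the counter, which is part of the state and not of
the input. So the states are determined explicitly instead of using `foldl_of_growth`. -/
theorem range {n : α → ℕ} (hn : PolyTime n) : PolyTime fun a => List.range (n a) := by
  obtain ⟨N, hN⟩ := hn.esize_le
  have key : ∀ m : ℕ, (List.replicate m ()).foldl
      (fun (s : ℕ × List ℕ) _ => (s.1 + 1, s.1 :: s.2)) (0, []) = (m, (List.range m).reverse) := by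
    intro m
    induction m with
    | zero => rfl
    | succ m ih => rw [List.replicate_succ', List.foldl_append, ih]; simp [List.range_succ]
  have h := foldl (init := fun _ : α => ((0 : ℕ), ([] : List ℕ)))
    (l := fun a => List.replicate (n a) ())
    (step := fun p : α × (ℕ × List ℕ) × Unit => (p.2.1.1 + 1, p.2.1.1 :: p.2.1.2))
    (const _) hn.replicate ((fst.comp (fst.comp snd)).succ.pair
      ((fst.comp (fst.comp snd)).cons (snd.comp (fst.comp snd))))
    (N + (N * (N + 1) + 1) + 1) (fun a l₁ hl₁ => ?_)
  · simp only [key] at h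
    simpa using (snd.comp h).reverse
  · obtain ⟨m, hm, rfl⟩ : ∃ m ≤ n a, l₁ = List.replicate m () :=
      ⟨l₁.length, by simpa using hl₁.length_le,
        List.eq_replicate_of_mem fun b _ => Subsingleton.elim _ _⟩
    rw [key]
    have e1 : m ≤ N.eval (esize a) := by have := hN a; rw [esize_nat] at this; omega
    have e2 : 2 * m + 1 ≤ N.eval (esize a) := by have := hN a; rw [esize_nat] at this; omega
    have e3 := esize_list_le (N.eval (esize a)) (List.range m).reverse fun b hb => by
      have : b < m := by simpa using hb
      rw [esize_nat]; omega
    have e4 := Nat.mul_le_mul_right (N.eval (esize a) + 1) e1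
    simp only [List.length_reverse, List.length_range] at e3
    simp only [esize_prod, esize_nat, Polynomial.eval_add, Polynomial.eval_mul,
      Polynomial.eval_one]
    omega

theorem takeD {n : α → ℕ} {l : α → List β} (hn : PolyTime n) (hl : PolyTime l) (d : β) :
    PolyTime fun a => (l a).takeD (n a) d := by
  have h := foldl_of_growth (init := fun a => (l a, ([] : List β)))
    (l := fun a => List.replicate (n a) ())
    (step := fun p : α × (List β × List β) × Unit =>
      (p.2.1.1.tail, p.2.1.1.headD d :: p.2.1.2))
    (hl.pair (const [])) hn.replicate ((fst.comp (fst.comp snd)).tail.pair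
      (((fst.comp (fst.comp snd)).headD (const d)).cons (snd.comp (fst.comp snd))))
    (Polynomial.C (esize d + 2)) (fun a s b hb => ?_)
  · have key : ∀ (m : ℕ) (r o : List β), (List.replicate m ()).foldl
        (fun (s : List β × List β) _ => (s.1.tail, s.1.headD d :: s.2)) (r, o) =
        (r.drop m, (r.takeD m d).reverse ++ o) := by
      intro m
      induction m with
      | zero => simp
      | succ m ih => intro r o; rw [List.replicate_succ, List.foldl_cons, ih]; simp
    simp only [key] at h
    simpa using (snd.comp h).reverse
  · obtain ⟨r, o⟩ := s
    cases r <;> simp <;> omega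

theorem zip {l : α → List β} {l' : α → List γ} (hl : PolyTime l) (hl' : PolyTime l') :
    PolyTime fun a => (l a).zip (l' a) := by
  obtain ⟨L, hL⟩ := hl.esize_le
  have hstep : PolyTime fun p : α × (List γ × List (β × γ)) × β =>
      ((match p.2.1.1 with
        | [] => ([], p.2.1.2)
        | c :: t => (t, (p.2.2, c) :: p.2.1.2) : List γ × List (β × γ))) :=
    listCases (g := fun q : (α × (List γ × List (β × γ)) × β) × γ × List γ =>
        (q.2.2, (q.1.2.2, q.2.1) :: q.1.2.1.2)) (fst.comp (fst.comp snd))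
      ((const []).pair (snd.comp (fst.comp snd)))
      ((snd.comp snd).pair (((snd.comp (snd.comp fst)).pair (fst.comp snd)).cons
        (snd.comp (fst.comp (snd.comp fst))))) (fun a h => by simp only [h])
      (fun a b t h => by simp only [h])
  have h := foldl_of_growth (init := fun a => (l' a, ([] : List (β × γ)))) (l := l)
    (hl'.pair (const [])) hl hstep (L + 1) (fun a s b hb => ?_)
  · have key : ∀ (m : List β) (r : List γ) (o : List (β × γ)), (m.foldl
        (fun (s : List γ × List (β × γ)) b => (match s.1 with
          | [] => ([], s.2)
          | c :: t => (t, (b, c) :: s.2) : List γ × List (β × γ))) (r, o)).2 =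
        (m.zip r).reverse ++ o := by
      intro m
      induction m with
      | nil => simp
      | cons b m ih =>
        intro r o
        cases r with
        | nil => simpa using ih [] o
        | cons c r => simpa using ih r ((b, c) :: o)
    have h' := (snd.comp h).reverse
    simp only [key] at h'
    simpa using h'
  · obtain ⟨r, o⟩ := s
    have := (esize_le_of_mem hb).trans (hL a)
    cases r
    · simp
    · simp; omega

/-- The list `L` is fixed and does not depend on the input; a separate program for each member is
allowed. It will be the list of agents. -/
theorem all_const {ι : Type} (L : List ι) {f : ι → α → Bool} (hf : ∀ i, PolyTime (f i)) :
    PolyTime fun a => L.all fun i => f i a := by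
  induction L with
  | nil => exact const true
  | cons i L ih => exact (hf i).and ih

end StackMachine.PolyTime

/-! ## Words, fields and binary numbers -/

namespace StackMachine

/-- Read a letter: a bit, or `none` for a separator. -/
def letterBit : Γ' → Option Bool
  | .bit b => some b
  | _ => none

/-- Write a letter: a bit, or a comma for `none`. -/
def bitLetter : Option Bool → Γ'
  | some b => .bit b
  | none => .comma

/-- Put one more letter in front of a list of fields. -/
def splitStep (fs : List (List Bool)) : Option Bool → List (List Bool)
  | none => [] :: fs
  | some b => (b :: fs.headD []) :: fs.tail

/-- The fields of a word that is given in reverse order. -/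
def splitFields (l : List (Option Bool)) : List (List Bool) := l.foldl splitStep [[]]

/-- Write down fields, in reverse order. -/
def joinFields (fs : List (List Bool)) : List (Option Bool) :=
  fs.foldl (fun o f => none :: ((f.map some).reverse ++ o)) []

theorem foldr_splitStep_bits (b : List Bool) (f : List Bool) (s : List (List Bool)) :
    (b.map some).foldr (fun x y => splitStep y x) (f :: s) = (b ++ f) :: s := by
  induction b with
  | nil => rfl
  | cons a b ih => rw [List.map_cons, List.foldr_cons, ih]; rfl

theorem foldr_splitStep_fields (l s : List (List Bool)) :
    ((encodeFields l).map letterBit).foldr (fun x y => splitStep y x) s = l ++ s := by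
  induction l with
  | nil => rfl
  | cons b l ih =>
    have h : (b.map Γ'.bit).map letterBit = b.map some := by simp [letterBit]
    have h' : encodeFields (b :: l) = b.map Γ'.bit ++ Γ'.comma :: encodeFields l := by
      simp [encodeFields]
    rw [h', List.map_append, List.foldr_append, h, List.map_cons, List.foldr_cons, ih]
    have := foldr_splitStep_bits b [] (l ++ s)
    simpa [splitStep, letterBit] using this

theorem splitFields_encodeFields (l : List (List Bool)) :
    splitFields ((encodeFields l).map letterBit).reverse = l ++ [[]] := by
  rw [splitFields, List.foldl_reverse, foldr_splitStep_fields]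

/-- The last comma closes the last field, and `ket` is read as a further separator. An empty field
therefore precedes the certificate, which is why `certRow` drops two fields, the target and this
one. -/
theorem splitFields_encodeFields_append (l : List (List Bool)) (w : List Bool) :
    splitFields ((encodeFields l ++ Γ'.ket :: w.map Γ'.bit).map letterBit).reverse =
      l ++ [[], w] := by
  have h : (w.map Γ'.bit).map letterBit = w.map some := by simp [letterBit]
  have h' : splitStep [w] (letterBit Γ'.ket) = [[], w] := rfl
  rw [splitFields, List.foldl_reverse, List.map_append, List.foldr_append, List.map_cons,
    List.foldr_cons, h, foldr_splitStep_bits, List.append_nil, h', foldr_splitStep_fields]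

theorem joinFields_encodeFields (l : List (List Bool)) :
    ((joinFields l).map bitLetter).reverse = encodeFields l := by
  have key : ∀ (l : List (List Bool)) (o : List (Option Bool)),
      ((l.foldl (fun o f => none :: ((f.map some).reverse ++ o)) o).map bitLetter).reverse =
        (o.map bitLetter).reverse ++ encodeFields l := by
    intro l
    induction l with
    | nil => simp [encodeFields]
    | cons b l ih =>
      intro o
      rw [List.foldl_cons, ih]
      simp [encodeFields, bitLetter, Function.comp_def]
  simpa [joinFields] using key l []

theorem esize_append {α : Type} [Enc α] (l l' : List α) :
    esize (l ++ l') + 1 = esize l + esize l' := by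
  induction l with
  | nil => simp; omega
  | cons a l ih => simp; omega

/-- The number with given binary digits, the least significant digit first. -/
def val : List Bool → ℕ
  | [] => 0
  | b :: l => b.toNat + 2 * val l

theorem val_encodeNat (n : ℕ) : val (encodeNat n) = n := by
  have key : ∀ p : PosNum, val (encodePosNum p) = (p : ℕ) := by
    intro p
    induction p with
    | one => rfl
    | bit1 p ih => simp [encodePosNum, val, ih, PosNum.cast_bit1]; omega
    | bit0 p ih => simp [encodePosNum, val, ih, PosNum.cast_bit0]; omega
  have key' : ∀ m : Num, val (encodeNum m) = (m : ℕ) := by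
    intro m
    cases m with
    | zero => rfl
    | pos p => exact key p
  rw [encodeNat, key', Num.to_of_nat]

theorem val_append (l l' : List Bool) : val (l ++ l') = val l + 2 ^ l.length * val l' := by
  induction l with
  | nil => simp [val]
  | cons b l ih => simp [val, ih, pow_succ]; ring

theorem val_eq (l : List Bool) : val l = (l.headD false).toNat + 2 * val l.tail := by
  cases l <;> simp [val]

/-- Add one digit: the state consists of the remaining digits of both numbers, the carry, and the
digits of the sum in reverse order. -/
def addStep (s : List Bool × List Bool × Bool × List Bool) :
    List Bool × List Bool × Bool × List Bool :=
  (s.1.tail, s.2.1.tail,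
    (s.1.headD false && s.2.1.headD false) ||
      (s.2.2.1 && (s.1.headD false || s.2.1.headD false)),
    Bool.xor (Bool.xor (s.1.headD false) (s.2.1.headD false)) s.2.2.1 :: s.2.2.2)

/-- Addition of binary numbers. -/
def add (a b : List Bool) : List Bool :=
  (((a ++ b).foldl (fun s _ => addStep s) (a, b, false, [])).2.2.1 ::
    ((a ++ b).foldl (fun s _ => addStep s) (a, b, false, [])).2.2.2).reverse

/-- The loop invariant: the digits written so far, plus the remaining numbers and the carry shifted
by the number of those digits, have a constant value. -/
theorem foldl_addStep (r : List Bool) : ∀ s : List Bool × List Bool × Bool × List Bool,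
    val (r.foldl (fun s _ => addStep s) s).2.2.2.reverse +
      2 ^ (s.2.2.2.length + r.length) * (val (s.1.drop r.length) + val (s.2.1.drop r.length) +
        (r.foldl (fun s _ => addStep s) s).2.2.1.toNat) =
      val s.2.2.2.reverse + 2 ^ s.2.2.2.length * (val s.1 + val s.2.1 + s.2.2.1.toNat) ∧
    (r.foldl (fun s _ => addStep s) s).2.2.2.length = s.2.2.2.length + r.length := by
  induction r with
  | nil => simp
  | cons x r ih =>
    intro s
    obtain ⟨h1, h2⟩ := ih (addStep s)
    obtain ⟨a, b, c, o⟩ := s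
    simp only [List.foldl_cons]
    constructor
    · have e1 : (addStep (a, b, c, o)).1.drop r.length = a.drop (x :: r).length := by
        simp [addStep]
      have e2 : (addStep (a, b, c, o)).2.1.drop r.length = b.drop (x :: r).length := by
        simp [addStep]
      have e3 : (addStep (a, b, c, o)).2.2.2.length + r.length = o.length + (x :: r).length := by
        simp [addStep]; omega
      rw [e1, e2, e3] at h1
      rw [h1]
      simp only [addStep, List.reverse_cons, val_append, List.length_cons, List.length_reverse]
      rw [val_eq a, val_eq b, pow_succ]
      cases a.headD false <;> cases b.headD false <;> cases c <;> simp [val] <;> ring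
    · rw [h2]
      simp [addStep]; omega

/-- The list `a ++ b` only serves as a clock, long enough to exhaust both numbers; the last carry is
the leading digit. -/
theorem val_add (a b : List Bool) : val (add a b) = val a + val b := by
  have h := foldl_addStep (a ++ b) (a, b, false, [])
  have e1 : a.drop (a ++ b).length = [] := by simp
  have e2 : b.drop (a ++ b).length = [] := by simp
  simp only [e1, e2] at h
  rw [add, List.reverse_cons, val_append, List.length_reverse, h.2]
  have := h.1
  simpa [val] using this

theorem length_add (a b : List Bool) : (add a b).length = a.length + b.length + 1 := by
  have h := (foldl_addStep (a ++ b) (a, b, false, [])).2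
  rw [add, List.length_reverse, List.length_cons, h]
  simp

/-- Compare one digit: the state consists of the remaining digits of both numbers and the result of
the comparison of the previous digits. -/
def leStep (s : List Bool × List Bool × Bool) : List Bool × List Bool × Bool :=
  (s.1.tail, s.2.1.tail,
    bif Bool.xor (s.1.headD false) (s.2.1.headD false) then s.2.1.headD false else s.2.2)

/-- Comparison of binary numbers. -/
def le (a b : List Bool) : Bool := ((a ++ b).foldl (fun s _ => leStep s) (a, b, true)).2.2

/-- Digits come with the least significant one first, so a later difference overrides the verdict
`c` on the earlier digits. -/
theorem foldl_leStep (r : List Bool) : ∀ (a b : List Bool) (c : Bool), a.length ≤ r.length →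
    b.length ≤ r.length → ((r.foldl (fun s _ => leStep s) (a, b, c)).2.2 = true ↔
      val a < val b ∨ val a = val b ∧ c = true) := by
  induction r with
  | nil =>
    intro a b c ha hb
    simp only [List.length_nil, Nat.le_zero, List.length_eq_zero_iff] at ha hb
    subst ha hb
    simp
  | cons x r ih =>
    intro a b c ha hb
    rw [List.foldl_cons, leStep, ih _ _ _ (by simp at *; omega) (by simp at *; omega), val_eq a,
      val_eq b]
    cases a.headD false <;> cases b.headD false <;> cases c <;> simp <;> omega

theorem le_iff (a b : List Bool) : le a b = true ↔ val a ≤ val b := by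
  rw [le, foldl_leStep _ _ _ _ (by simp) (by simp)]
  simp [le_iff_lt_or_eq]

/-- The sum of the selected numbers. -/
def sumSelected (p : List (List Bool)) (X : List Bool) : List Bool :=
  (p.zip X).foldl (fun s a => bif a.2 then add s a.1 else s) []

theorem val_sumSelected {n : ℕ} (p : Fin n → List Bool) (χ : Fin n → Bool) :
    val (sumSelected (List.ofFn p) (List.ofFn χ)) = ∑ v, if χ v then val (p v) else 0 := by
  have key : ∀ (n : ℕ) (p : Fin n → List Bool) (χ : Fin n → Bool) (s : List Bool),
      val (((List.ofFn p).zip (List.ofFn χ)).foldl (fun s a => bif a.2 then add s a.1 else s) s) =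
        val s + ∑ v, if χ v then val (p v) else 0 := by
    intro n
    induction n with
    | zero => simp
    | succ n ih =>
      intro p χ s
      rw [List.ofFn_succ, List.ofFn_succ, List.zip_cons_cons, List.foldl_cons, ih, Fin.sum_univ_succ]
      cases χ 0 <;> simp [val_add]
      omega
  rw [sumSelected, key]
  simp [val]

/-- No two selected vertices are adjacent. -/
def indep (rows : List (List Bool)) (X : List Bool) : Bool :=
  (rows.zip X).all fun a => !a.2 || (a.1.zip X).all fun b => !(b.1 && b.2)

theorem all_zip_ofFn {α β : Type} {n : ℕ} (f : Fin n → α) (g : Fin n → β) (P : α × β → Bool) :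
    ((List.ofFn f).zip (List.ofFn g)).all P = true ↔ ∀ v, P (f v, g v) = true := by
  induction n with
  | zero => simp
  | succ n ih => simp [List.ofFn_succ, Fin.forall_fin_succ, ih]

theorem indep_iff {n : ℕ} (A : Fin n → Fin n → Bool) (χ : Fin n → Bool) :
    indep (List.ofFn fun u => List.ofFn fun v => A u v) (List.ofFn χ) = true ↔
      ∀ u v, χ u = true → χ v = true → A u v = false := by
  rw [indep, all_zip_ofFn]
  refine forall_congr' fun u => ?_
  simp only [Bool.or_eq_true, all_zip_ofFn]
  cases χ u
  · simp
  · simp only [Bool.not_true, Bool.false_eq_true, false_or, forall_const]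
    refine forall_congr' fun v => ?_
    cases χ v <;> simp

/-- No vertex is selected twice. -/
def disj (X Y : List Bool) : Bool := (X.zip Y).all fun a => !(a.1 && a.2)

theorem disj_iff {n : ℕ} (χ ξ : Fin n → Bool) :
    disj (List.ofFn χ) (List.ofFn ξ) = true ↔ ∀ v, ¬ (χ v = true ∧ ξ v = true) := by
  rw [disj, all_zip_ofFn]
  refine forall_congr' fun v => ?_
  cases χ v <;> simp

/-- A word of any length is thereby read as a vector indexed by the `n` vertices, which gives
arbitrary certificates a meaning. -/
theorem takeD_eq_ofFn {α : Type} (n : ℕ) (l : List α) (d : α) :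
    l.takeD n d = List.ofFn fun v : Fin n => l.getD v d := by
  induction n generalizing l with
  | zero => simp
  | succ n ih =>
    rw [List.ofFn_succ, List.takeD, ih]
    cases l <;> simp

theorem drop_flatten_ofFn {α : Type} {n k : ℕ} (B : Fin k → List α) (hB : ∀ j, (B j).length = n)
    (r : List α) : ((List.ofFn B).flatten ++ r).drop (k * n) = r := by
  rw [List.drop_append_of_le_length, List.drop_eq_nil_of_le]
  · rfl
  all_goals simp [List.length_flatten, Function.comp_def, hB]

theorem takeD_drop_flatten_ofFn {α : Type} {n : ℕ} (d : α) (r : List α) :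
    ∀ {k : ℕ} (B : Fin k → List α) (_ : ∀ j, (B j).length = n) (j : Fin k),
      (((List.ofFn B).flatten ++ r).drop (j * n)).takeD n d = B j := by
  intro k
  induction k with
  | zero => exact fun B hB j => j.elim0
  | succ k ih =>
    intro B hB j
    rw [List.ofFn_succ, List.flatten_cons, List.append_assoc]
    refine Fin.cases ?_ (fun j => ?_) j
    · simpa using List.takeD_left' (hB 0)
    · have : ((j.succ : Fin (k + 1)) : ℕ) * n = (B 0).length + j * n := by
        rw [hB 0, Fin.val_succ]; ring
      rw [this, ← List.drop_drop, List.drop_left]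
      exact ih (fun j => B j.succ) (fun j => hB j.succ) j

end StackMachine

/-! ## The algorithms for Fair Division -/

namespace StackMachine

section
variable {α : Type} [Enc α]

namespace PolyTime

theorem splitFields {l : α → List (Option Bool)} (hl : PolyTime l) :
    PolyTime fun a => splitFields (l a) := by
  have hstep : PolyTime fun p : α × List (List Bool) × Option Bool => splitStep p.2.1 p.2.2 :=
    optionCases (snd.comp snd) ((const []).cons (fst.comp snd))
      (g := fun q : (α × List (List Bool) × Option Bool) × Bool =>
        (q.2 :: q.1.2.1.headD []) :: q.1.2.1.tail)
      ((snd.cons ((fst.comp (snd.comp fst)).headD (const []))).cons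
        (fst.comp (snd.comp fst)).tail) (fun a h => by simp [h, splitStep])
      (fun a b h => by simp [h, splitStep])
  refine foldl_of_growth (const _) hl hstep 10 fun a s b _ => ?_
  rcases b with _ | b
  · simp [splitStep]; omega
  · have := esize_bool_le b
    cases s <;> simp [splitStep] <;> omega

theorem joinFields {l : α → List (List Bool)} (hl : PolyTime l) :
    PolyTime fun a => joinFields (l a) := by
  have hmap : PolyTime fun f : List Bool => (f.map Option.some).reverse :=
    (map id (f := fun p : List Bool × Bool => Option.some p.2) snd.some).reverse
  obtain ⟨M, hM⟩ := hmap.esize_le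
  obtain ⟨L, hL⟩ := hl.esize_le
  have hstep : PolyTime fun p : α × List (Option Bool) × List Bool =>
      (none :: ((p.2.2.map Option.some).reverse ++ p.2.1) : List (Option Bool)) :=
    (const none).cons ((hmap.comp (snd.comp snd)).append (fst.comp snd))
  refine foldl_of_growth (const _) hl hstep (M.comp L + 2) fun a s b hb => ?_
  have h1 := esize_append (b.map Option.some).reverse s
  have h2 := (hM b).trans (M.eval_le_eval_of_le_nat ((esize_le_of_mem hb).trans (hL a)))
  simp only [esize_cons, esize_none, Polynomial.eval_add, Polynomial.eval_comp,
    Polynomial.eval_ofNat]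
  omega

theorem add {x y : α → List Bool} (hx : PolyTime x) (hy : PolyTime y) :
    PolyTime fun a => add (x a) (y a) := by
  have h1 : PolyTime fun p : α × (List Bool × List Bool × Bool × List Bool) × Bool =>
      p.2.1.1.headD false := (fst.comp (fst.comp snd)).headD (const false)
  have h2 : PolyTime fun p : α × (List Bool × List Bool × Bool × List Bool) × Bool =>
      p.2.1.2.1.headD false := (fst.comp (snd.comp (fst.comp snd))).headD (const false)
  have h3 : PolyTime fun p : α × (List Bool × List Bool × Bool × List Bool) × Bool =>
      p.2.1.2.2.1 := fst.comp (snd.comp (snd.comp (fst.comp snd)))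
  have hstep : PolyTime fun p : α × (List Bool × List Bool × Bool × List Bool) × Bool =>
      addStep p.2.1 :=
    (fst.comp (fst.comp snd)).tail.pair ((fst.comp (snd.comp (fst.comp snd))).tail.pair
      (((h1.and h2).or (h3.and (h1.or h2))).pair (((h1.xor h2).xor h3).cons
        (snd.comp (snd.comp (snd.comp (fst.comp snd)))))))
  have h := foldl_of_growth (init := fun a => (x a, y a, false, ([] : List Bool)))
    (hx.pair (hy.pair (const _))) (hx.append hy) hstep 10 fun a s b _ => ?_
  · exact ((fst.comp (snd.comp (snd.comp h))).cons (snd.comp (snd.comp (snd.comp h)))).reverse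
  · obtain ⟨x, y, c, o⟩ := s
    have e1 := esize_bool_le ((x.headD false && y.headD false) ||
      (c && (x.headD false || y.headD false)))
    have e2 := esize_bool_le (Bool.xor (Bool.xor (x.headD false) (y.headD false)) c)
    have e3 : ∀ l : List Bool, esize l.tail ≤ esize l := by
      intro l; cases l <;> simp; omega
    have e4 := e3 x
    have e5 := e3 y
    simp only [addStep, esize_prod, esize_cons, Polynomial.eval_ofNat]
    omega

theorem le {x y : α → List Bool} (hx : PolyTime x) (hy : PolyTime y) :
    PolyTime fun a => le (x a) (y a) := by
  have h1 : PolyTime fun p : α × (List Bool × List Bool × Bool) × Bool =>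
      p.2.1.1.headD false := (fst.comp (fst.comp snd)).headD (const false)
  have h2 : PolyTime fun p : α × (List Bool × List Bool × Bool) × Bool =>
      p.2.1.2.1.headD false := (fst.comp (snd.comp (fst.comp snd))).headD (const false)
  have hstep : PolyTime fun p : α × (List Bool × List Bool × Bool) × Bool => leStep p.2.1 :=
    (fst.comp (fst.comp snd)).tail.pair ((fst.comp (snd.comp (fst.comp snd))).tail.pair
      ((h1.xor h2).cond h2 (snd.comp (snd.comp (fst.comp snd)))))
  have h := foldl_of_growth (init := fun a => (x a, y a, true))
    (hx.pair (hy.pair (const _))) (hx.append hy) hstep 10 fun a s b _ => ?_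
  · exact snd.comp (snd.comp h)
  · obtain ⟨x, y, c⟩ := s
    have e1 := esize_bool_le (bif Bool.xor (x.headD false) (y.headD false) then y.headD false else c)
    have e3 : ∀ l : List Bool, esize l.tail ≤ esize l := by
      intro l; cases l <;> simp; omega
    have e4 := e3 x
    have e5 := e3 y
    simp only [leStep, esize_prod, Polynomial.eval_ofNat]
    omega

theorem sumSelected {p : α → List (List Bool)} {X : α → List Bool} (hp : PolyTime p)
    (hX : PolyTime X) : PolyTime fun a => sumSelected (p a) (X a) := by
  obtain ⟨L, hL⟩ := (hp.zip hX).esize_le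
  have hstep : PolyTime fun q : α × List Bool × List Bool × Bool =>
      (bif q.2.2.2 then StackMachine.add q.2.1 q.2.2.1 else q.2.1 : List Bool) :=
    cond (snd.comp (snd.comp snd)) ((fst.comp snd).add (fst.comp (snd.comp snd))) (fst.comp snd)
  -- The measure is the number of digits; a digit takes at most `3` symbols and its cons node one
  -- more, hence the factor `4`.
  refine foldl_of_measure (const []) (hp.zip hX) hstep List.length 4 length_le_esize
    (fun s => ?_) (L + 1) fun a s b hb => ?_
  · have := esize_list_le 3 s fun b _ => esize_bool_le b
    omega
  · have h1 := (esize_le_of_mem hb).trans (hL a)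
    obtain ⟨f, c⟩ := b
    have h2 := length_le_esize f
    cases c
    · simp
    · simp only [cond_true, length_add, Polynomial.eval_add, Polynomial.eval_one, esize_prod]
        at h1 ⊢
      omega

theorem indep {r : α → List (List Bool)} {X : α → List Bool} (hr : PolyTime r)
    (hX : PolyTime X) : PolyTime fun a => indep (r a) (X a) :=
  all (hr.zip hX) (f := fun p : α × List Bool × Bool => !p.2.2 ||
    (p.2.1.zip (X p.1)).all fun b => !(b.1 && b.2))
    ((snd.comp snd).not.or (all (f := fun q : (α × List Bool × Bool) × Bool × Bool =>
      !(q.2.1 && q.2.2)) ((fst.comp snd).zip (hX.comp fst))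
      ((fst.comp snd).and (snd.comp snd)).not))

theorem disj {X Y : α → List Bool} (hX : PolyTime X) (hY : PolyTime Y) :
    PolyTime fun a => disj (X a) (Y a) :=
  all (f := fun q : α × Bool × Bool => !(q.2.1 && q.2.2)) (hX.zip hY)
    ((fst.comp snd).and (snd.comp snd)).not

theorem mul_const {n : α → ℕ} (hn : PolyTime n) (j : ℕ) : PolyTime fun a => j * n a := by
  induction j with
  | zero => simpa using const 0
  | succ j ih =>
    convert (ih.replicate.append hn.replicate).length using 2 with a
    simp [Nat.succ_mul]

end PolyTime
end

/-- The number of vertices of the graph given by the fields. -/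
def numVertices (fs : List (List Bool)) : ℕ := (fs.headD []).length

/-- The adjacency matrix of the graph given by the fields. -/
def matrix (fs : List (List Bool)) : List (List Bool) := fs.tail.takeD (numVertices fs) []

/-- The fields after those for the graph. -/
def afterGraph (fs : List (List Bool)) : List (List Bool) := fs.tail.drop (numVertices fs)

theorem PolyTime.numVertices : PolyTime numVertices := (PolyTime.id.headD (.const [])).length

theorem PolyTime.matrix : PolyTime matrix := PolyTime.numVertices.takeD PolyTime.id.tail []

theorem PolyTime.afterGraph : PolyTime afterGraph := PolyTime.numVertices.drop PolyTime.id.tail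

/-- The `j`-th profit function. -/
def profitRow (j : ℕ) (fs : List (List Bool)) : List (List Bool) :=
  ((afterGraph fs).drop (j * numVertices fs)).takeD (numVertices fs) []

/-- The fields after `k` profit functions. -/
def afterProfits (k : ℕ) (fs : List (List Bool)) : List (List Bool) :=
  (afterGraph fs).drop (k * numVertices fs)

/-- The characteristic vector of the `j`-th set of the certificate. -/
def certRow (k j : ℕ) (fs : List (List Bool)) : List Bool :=
  ((((afterProfits k fs).drop 2).headD []).drop (j * numVertices fs)).takeD (numVertices fs) false

/-- The verifier for Fair Division. -/
def verify (k : ℕ) (fs : List (List Bool)) : Bool :=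
  (List.range k).all fun j => (indep (matrix fs) (certRow k j fs) &&
    le ((afterProfits k fs).headD []) (sumSelected (profitRow j fs) (certRow k j fs))) &&
    (List.range k).all fun i => i == j || disj (certRow k i fs) (certRow k j fs)

theorem PolyTime.verify (k : ℕ) : PolyTime (verify k) := by
  have hp : PolyTime (afterProfits k) := (PolyTime.numVertices.mul_const k).drop PolyTime.afterGraph
  have hc : ∀ j, PolyTime (certRow k j) := fun j => PolyTime.numVertices.takeD
    ((PolyTime.numVertices.mul_const j).drop (((PolyTime.const 2).drop hp).headD (.const []))) false
  have hr : ∀ j, PolyTime (profitRow j) := fun j => PolyTime.numVertices.takeD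
    ((PolyTime.numVertices.mul_const j).drop PolyTime.afterGraph) []
  exact .all_const _ fun j => ((PolyTime.matrix.indep (hc j)).and
    (.le (hp.headD (.const [])) (.sumSelected (hr j) (hc j)))).and
    (.all_const _ fun i => (PolyTime.const (i == j)).or ((hc i).disj (hc j)))

/-- The characteristic vector of the complement of a list of vertices. -/
def complement (n : ℕ) (ds : List ℕ) : List Bool := (List.range n).map fun i => !ds.any (i == ·)

/-- The complement of `ds` is an independent set of at least the given size. -/
def coIndep (fs : List (List Bool)) (q : List Bool) (ds : List ℕ) : Bool :=
  indep (matrix fs) (complement (numVertices fs) ds) &&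
    le q (sumSelected ((matrix fs).map fun _ => [true]) (complement (numVertices fs) ds))

/-- Search for a set of at most `c` vertices such that the complement of the union with `ds` is an
independent set of at least the given size. -/
def search (fs : List (List Bool)) (q : List Bool) : ℕ → List ℕ → Bool
  | 0, ds => coIndep fs q ds
  | c + 1, ds => search fs q c ds || (List.range (numVertices fs)).any fun d =>
      search fs q c (d :: ds)

/-- The number of vertices in binary. -/
def numVerticesBinary (fs : List (List Bool)) : List Bool :=
  sumSelected ((matrix fs).map fun _ => [true]) ((matrix fs).map fun _ => true)

/-- The target, the profits of the first agent, and the profits of the others, in the instance of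
Fair Division that is made from an instance of Independent Set. -/
def newNumbers (K : ℕ) (fs : List (List Bool)) : List Bool × List Bool × List Bool :=
  bif le (add ((afterGraph fs).headD []) (encodeNat K)) (numVerticesBinary fs) then
    ((afterGraph fs).headD [], [true], (afterGraph fs).headD [])
  else bif search fs ((afterGraph fs).headD []) K [] then ([], [], []) else ([true], [], [])

/-- The reduction from Independent Set to Fair Division with `K + 1` agents. -/
def reduce (K : ℕ) (fs : List (List Bool)) : List (List Bool) :=
  fs.headD [] :: (matrix fs ++ ((matrix fs).map (fun _ => (newNumbers K fs).2.1) ++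
    ((List.replicate K ((matrix fs).map fun _ => (newNumbers K fs).2.2)).flatten ++
      [(newNumbers K fs).1])))

/-- Each level of the recursion adds one loop over the vertices. The degree of the time bound grows
with `c`, but `c` is a constant. -/
theorem PolyTime.search (c : ℕ) : PolyTime fun p : (List (List Bool) × List Bool) × List ℕ =>
    search p.1.1 p.1.2 c p.2 := by
  induction c with
  | zero =>
    have hc : PolyTime fun p : (List (List Bool) × List Bool) × List ℕ =>
        complement (StackMachine.numVertices p.1.1) p.2 :=
      .map (f := fun q : ((List (List Bool) × List Bool) × List ℕ) × ℕ =>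
        !q.1.2.any (q.2 == ·)) (.range (PolyTime.numVertices.comp (fst.comp fst)))
        (.not (.any (f := fun r : (((List (List Bool) × List Bool) × List ℕ) × ℕ) × ℕ =>
          r.1.2 == r.2) (snd.comp fst) ((snd.comp fst).natBeq snd)))
    have hm : PolyTime fun p : (List (List Bool) × List Bool) × List ℕ =>
        StackMachine.matrix p.1.1 := PolyTime.matrix.comp (fst.comp fst)
    exact (hm.indep hc).and (.le (snd.comp fst) (.sumSelected (.map (f := fun _ => [true]) hm
      (.const _)) hc))
  | succ c ih =>
    exact ih.or (.any (f := fun q : ((List (List Bool) × List Bool) × List ℕ) × ℕ =>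
      StackMachine.search q.1.1.1 q.1.1.2 c (q.2 :: q.1.2))
      (.range (PolyTime.numVertices.comp (fst.comp fst)))
      (ih.comp ((fst.comp fst).pair (snd.cons (snd.comp fst)))))

theorem PolyTime.newNumbers (K : ℕ) : PolyTime (newNumbers K) := by
  have hq : PolyTime fun fs => (StackMachine.afterGraph fs).headD [] :=
    PolyTime.afterGraph.headD (.const [])
  have hn : PolyTime numVerticesBinary :=
    .sumSelected (.map (f := fun _ => [true]) PolyTime.matrix (.const _))
      (.map (f := fun _ => true) PolyTime.matrix (.const _))
  have hs : PolyTime fun fs =>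
      StackMachine.search fs ((StackMachine.afterGraph fs).headD []) K [] :=
    (PolyTime.search K).comp ((PolyTime.id.pair hq).pair (.const []))
  exact .cond ((hq.add (.const _)).le hn) (hq.pair ((PolyTime.const _).pair hq))
    (.cond hs (.const _) (.const _))

theorem PolyTime.reduce (K : ℕ) : PolyTime (reduce K) := by
  have h1 : PolyTime fun fs => (StackMachine.matrix fs).map fun _ =>
      (StackMachine.newNumbers K fs).2.1 :=
    .map (f := fun p : List (List Bool) × List Bool => (StackMachine.newNumbers K p.1).2.1)
      PolyTime.matrix (fst.comp (snd.comp ((PolyTime.newNumbers K).comp fst)))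
  have h2 : PolyTime fun fs => (StackMachine.matrix fs).map fun _ =>
      (StackMachine.newNumbers K fs).2.2 :=
    .map (f := fun p : List (List Bool) × List Bool => (StackMachine.newNumbers K p.1).2.2)
      PolyTime.matrix (snd.comp (snd.comp ((PolyTime.newNumbers K).comp fst)))
  have h3 : ∀ m : ℕ, PolyTime fun fs => (List.replicate m ((StackMachine.matrix fs).map fun _ =>
      (StackMachine.newNumbers K fs).2.2)).flatten := by
    intro m
    induction m with
    | zero => exact .const []
    | succ m ih => exact h2.append ih
  exact (PolyTime.id.headD (.const [])).cons (PolyTime.matrix.append (h1.append ((h3 K).append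
    ((fst.comp (PolyTime.newNumbers K)).cons (.const [])))))

end StackMachine

/-! ## Correctness of the algorithms -/

namespace StackMachine

section graphFields
variable {n : ℕ} (G : SimpleGraph (Fin n)) (s : List (List Bool))

theorem numVertices_graphFields : numVertices (graphFields G ++ s) = n := by
  simp [numVertices, graphFields]

open Classical in
theorem matrix_graphFields : matrix (graphFields G ++ s) =
    List.ofFn fun u => List.ofFn fun v => decide (G.Adj u v) := by
  rw [matrix, numVertices_graphFields]
  exact List.takeD_left' (by simp)

theorem afterGraph_graphFields : afterGraph (graphFields G ++ s) = s := by
  rw [afterGraph, numVertices_graphFields]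
  exact List.drop_left' (by simp)

open Classical in
theorem indep_matrix_iff (χ : Fin n → Bool) :
    indep (matrix (graphFields G ++ s)) (List.ofFn χ) = true ↔
      G.IsIndepSet {v | χ v = true} := by
  rw [matrix_graphFields, indep_iff]
  constructor
  · intro h u hu v hv _
    simpa using h u v hu hv
  · intro h u v hu hv
    by_cases huv : u = v
    · subst huv; simp
    · simpa using h hu hv huv

end graphFields

/-- Here `χ` is whatever the verifier reads from `w`. This covers certificates made from a coloring
as well as arbitrary words. -/
theorem verify_eq_true_iff {k : ℕ} (x : FairDivisionInput k) (w : List Bool)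
    (χ : Fin k → Fin x.n → Bool)
    (hχ : ∀ j : Fin k, (w.drop (j * x.n)).takeD x.n false = List.ofFn (χ j)) :
    verify k (graphFields x.graph ++ (profitFields x.profit ++ [encodeNat x.target]) ++ [[], w]) =
      true ↔ (∀ i j, i ≠ j → ∀ v, ¬ (χ i v = true ∧ χ j v = true)) ∧
        ∀ j, x.graph.IsIndepSet {v | χ j v = true} ∧
          x.target ≤ ∑ v, if χ j v then x.profit j v else 0 := by
  rw [List.append_assoc]
  set s := profitFields x.profit ++ [encodeNat x.target] ++ [[], w] with hs
  have hs' : s = (List.ofFn fun j => List.ofFn fun v => encodeNat (x.profit j v)).flatten ++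
      (encodeNat x.target :: [[], w]) := by
    rw [hs, List.append_assoc]; rfl
  have h1 : afterProfits k (graphFields x.graph ++ s) = encodeNat x.target :: [[], w] := by
    rw [afterProfits, afterGraph_graphFields, numVertices_graphFields, hs',
      drop_flatten_ofFn _ (fun j => by simp)]
  have h2 : ∀ j : Fin k, certRow k j (graphFields x.graph ++ s) = List.ofFn (χ j) := by
    intro j
    rw [certRow, h1, numVertices_graphFields]
    exact hχ j
  have h3 : ∀ j : Fin k, profitRow j (graphFields x.graph ++ s) =
      List.ofFn fun v => encodeNat (x.profit j v) := by
    intro j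
    rw [profitRow, afterGraph_graphFields, numVertices_graphFields, hs',
      takeD_drop_flatten_ofFn _ _ _ (fun j => by simp)]
  have h4 : verify k (graphFields x.graph ++ s) = true ↔ ∀ j : Fin k,
      (x.graph.IsIndepSet {v | χ j v = true} ∧
        x.target ≤ ∑ v, if χ j v then x.profit j v else 0) ∧
      ∀ i : Fin k, i = j ∨ ∀ v, ¬ (χ i v = true ∧ χ j v = true) := by
    simp only [verify, List.all_eq_true, List.mem_range, Bool.and_eq_true, Bool.or_eq_true,
      beq_iff_eq, le_iff]
    rw [Fin.forall_iff]
    refine forall₂_congr fun j hj => ?_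
    have e2 := h2 ⟨j, hj⟩
    have e3 := h3 ⟨j, hj⟩
    simp only at e2 e3
    rw [e2, e3, indep_matrix_iff, h1, val_sumSelected]
    simp only [val_encodeNat, List.headD_cons]
    refine and_congr Iff.rfl ?_
    rw [Fin.forall_iff]
    refine forall₂_congr fun i hi => ?_
    have e4 := h2 ⟨i, hi⟩
    simp only at e4
    rw [e4, disj_iff]
    simp
  rw [h4]
  constructor
  · exact fun h => ⟨fun i j hij => ((h j).2 i).resolve_left hij, fun j => (h j).1⟩
  · intro h j
    refine ⟨h.2 j, fun i => ?_⟩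
    by_cases hij : i = j
    · exact .inl hij
    · exact .inr (h.1 i j hij)

/-- Over an empty index set the infimum in `ℕ` is `0` by convention, so the case `k = 0` has to be
excluded. -/
theorem le_satisfactionLevel_iff {k n : ℕ} (hk : 1 ≤ k) (p : Fin k → Fin n → ℕ)
    (X : Fin k → Finset (Fin n)) (t : ℕ) :
    t ≤ satisfactionLevel p X ↔ ∀ j, t ≤ ∑ v ∈ X j, p j v := by
  have : Nonempty (Fin k) := ⟨⟨0, hk⟩⟩
  exact le_ciInf_iff (OrderBot.bddBelow _)

/-- The unary first field and its comma already take `n + 1` letters. Both the length of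
certificates and the size of the new numbers are bounded through this. -/
theorem lt_length_encodeFields {n : ℕ} (G : SimpleGraph (Fin n)) (s : List (List Bool)) :
    n < (encodeFields (graphFields G ++ s)).length := by
  simp [encodeFields, graphFields]

/-- Stated for any problem on such inputs with the same encoding, in order to cover both the full
problem and its restriction to small numbers. -/
theorem inNP_of_fairDivision {k : ℕ} (hk : 1 ≤ k) (P : DecisionProblem)
    (f : P.Inst → FairDivisionInput k) (hf : ∀ x, P.enc x = (f x).encode)
    (hP : ∀ x, x ∈ P.yes ↔ ∃ X : Fin k → Finset (Fin (f x).n),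
      IsPartialColoring (f x).graph X ∧ (f x).target ≤ satisfactionLevel (f x).profit X) :
    P.InNP := by
  classical
  have hsplit : ∀ x w, splitFields ((P.encPair (x, w)).map letterBit).reverse =
      graphFields (f x).graph ++ (profitFields (f x).profit ++ [encodeNat (f x).target]) ++
        [[], w] := by
    intro x w
    rw [DecisionProblem.encPair, hf, FairDivisionInput.encode, splitFields_encodeFields_append]
  -- A certificate consists of `k` vectors of `n` bits each, and `n` is less than the input length.
  refine ⟨Polynomial.C k * Polynomial.X,
    fun z => verify k (splitFields ((P.encPair z).map letterBit).reverse),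
    computableInPolyTime_of_polyTime (idComputableInPolyTime P.encPair) letterBit
      (fun o => o.getD false) (g := fun l => [some (verify k (splitFields l))])
      (.cons (.some ((PolyTime.verify k).comp (.splitFields .id))) (.const [])) _
      (fun a => rfl), fun x => ?_⟩
  rw [hP]
  constructor
  · rintro ⟨X, ⟨hX1, hX2⟩, hX3⟩
    refine ⟨(List.ofFn fun j => List.ofFn fun v => decide (v ∈ X j)).flatten, ?_, ?_⟩
    · have h1 := (lt_length_encodeFields (f x).graph
        (profitFields (f x).profit ++ [encodeNat (f x).target])).le
      rw [hf, FairDivisionInput.encode]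
      simpa [List.length_flatten, Function.comp_def] using Nat.mul_le_mul_left k h1
    · beta_reduce
      rw [hsplit, verify_eq_true_iff (f x) _ fun j v => decide (v ∈ X j)]
      · rw [le_satisfactionLevel_iff hk] at hX3
        refine ⟨fun i j hij v => ?_, fun j => ⟨?_, ?_⟩⟩
        · simpa using fun h1 h2 => Finset.disjoint_left.mp (hX1 hij) h1 h2
        · simpa using hX2 j
        · simpa using hX3 j
      · intro j
        have := takeD_drop_flatten_ofFn (n := (f x).n) false [] (fun j => List.ofFn fun v => decide (v ∈ X j))
          (fun j => by simp) j
        simpa using this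
  · rintro ⟨w, -, hw⟩
    beta_reduce at hw
    rw [hsplit, verify_eq_true_iff (f x) w fun j v => (w.drop (j * (f x).n)).getD v false] at hw
    · refine ⟨fun j => Finset.univ.filter fun v => (w.drop (j * (f x).n)).getD v false = true,
        ⟨fun i j hij => ?_, fun j => ?_⟩, ?_⟩
      · beta_reduce
        rw [Finset.disjoint_left]
        intro v h1 h2
        exact hw.1 i j hij v ⟨(Finset.mem_filter.mp h1).2, (Finset.mem_filter.mp h2).2⟩
      · have := (hw.2 j).1
        rwa [Finset.coe_filter_univ]
      · rw [le_satisfactionLevel_iff hk]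
        intro j
        rw [Finset.sum_filter]
        exact (hw.2 j).2
    · exact fun j => takeD_eq_ofFn _ _ _

/-! ### Independent sets with small complement -/

open Classical in
theorem coIndep_iff {n : ℕ} (G : SimpleGraph (Fin n)) (s : List (List Bool)) (q : List Bool)
    (ds : List ℕ) : coIndep (graphFields G ++ s) q ds = true ↔
      G.IsIndepSet {v | (v : ℕ) ∉ ds} ∧ val q ≤ {v : Fin n | (v : ℕ) ∉ ds}.toFinset.card := by
  have h1 : complement n ds = List.ofFn fun v : Fin n => !ds.any ((v : ℕ) == ·) := by
    rw [complement, List.ofFn_eq_map, ← List.map_coe_finRange_eq_range, List.map_map]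
    rfl
  have h2 : ∀ v : Fin n, (!ds.any ((v : ℕ) == ·)) = true ↔ (v : ℕ) ∉ ds := by
    intro v
    simp only [Bool.not_eq_true', List.any_eq_false, beq_iff_eq]
    exact ⟨fun h hv => h _ hv rfl, fun h x hx e => h (e ▸ hx)⟩
  have h3 : (matrix (graphFields G ++ s)).map (fun _ => [true]) = List.ofFn fun _ : Fin n => [true] := by
    rw [matrix_graphFields, List.map_ofFn]; rfl
  rw [coIndep, Bool.and_eq_true, numVertices_graphFields, h1, h3, indep_matrix_iff, le_iff,
    val_sumSelected]
  simp only [h2, Finset.card_eq_sum_ones, Set.toFinset_ofPred, Finset.sum_filter]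
  rfl

theorem search_iff (fs : List (List Bool)) (q : List Bool) (c : ℕ) : ∀ ds,
    search fs q c ds = true ↔ ∃ ds' : List ℕ, ds'.length ≤ c ∧ (∀ d ∈ ds', d < numVertices fs) ∧
      coIndep fs q (ds' ++ ds) = true := by
  induction c with
  | zero =>
    intro ds
    simp [search]
  | succ c ih =>
    intro ds
    rw [search, Bool.or_eq_true, ih, List.any_eq_true]
    constructor
    · rintro (⟨ds', h1, h2, h3⟩ | ⟨d, hd, h⟩)
      · exact ⟨ds', by omega, h2, h3⟩
      · obtain ⟨ds', h1, h2, h3⟩ := (ih _).mp h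
        refine ⟨ds' ++ [d], by simpa using h1, ?_, by simpa using h3⟩
        simp only [List.mem_append, List.mem_singleton]
        rintro e (he | rfl)
        · exact h2 e he
        · exact List.mem_range.mp hd
    · rintro ⟨ds', h1, h2, h3⟩
      -- The vertex chosen first by `search` is put directly in front of `ds`, so it is the last
      -- element of `ds'`.
      rcases List.eq_nil_or_concat ds' with rfl | ⟨ds'', d, rfl⟩
      · exact .inl ⟨[], by simp, by simp, h3⟩
      · rw [List.concat_eq_append] at h1 h2 h3
        refine .inr ⟨d, List.mem_range.mpr (h2 d (by simp)), (ih _).mpr ⟨ds'', by simpa using h1,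
          fun e he => h2 e (by simp [he]), by simpa using h3⟩⟩

/-- By `hc`, a set with at least `val q` vertices has fewer than `c` vertices in its complement, so
the search meets this complement. -/
theorem search_graphFields_iff {n : ℕ} (G : SimpleGraph (Fin n)) (s : List (List Bool))
    (q : List Bool) (c : ℕ) (hc : n < val q + c) :
    search (graphFields G ++ s) q c [] = true ↔
      ∃ X : Finset (Fin n), G.IsIndepSet X ∧ val q ≤ X.card := by
  classical
  rw [search_iff]
  constructor
  · rintro ⟨ds, -, -, h⟩
    obtain ⟨h1, h2⟩ := (coIndep_iff _ _ _ _).mp h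
    exact ⟨_, by simpa using h1, h2⟩
  · rintro ⟨X, h1, h2⟩
    have h3 := Finset.card_le_univ X
    have h4 := Finset.card_compl X
    rw [Fintype.card_fin] at h3 h4
    have h5 : {v : Fin n | (v : ℕ) ∉ Xᶜ.toList.map (fun v : Fin n => (v : ℕ)) ++ []} = X := by
      ext v
      simp only [List.append_nil, List.mem_map, Finset.mem_toList, Finset.mem_compl,
        Set.mem_ofPred_eq, Finset.mem_coe, not_exists, not_and]
      refine ⟨fun h => by_contra fun hv => h v hv rfl, fun h w hw e => hw ?_⟩
      rwa [Fin.ext e]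
    refine ⟨Xᶜ.toList.map fun v : Fin n => (v : ℕ), by simp; omega, ?_, (coIndep_iff _ _ _ _).mpr ?_⟩
    · rw [numVertices_graphFields]
      simp only [List.mem_map]
      rintro _ ⟨v, -, rfl⟩
      exact v.2
    · simp only [h5, Finset.toFinset_coe]
      exact ⟨h1, h2⟩

/-! ### The reduction from Independent Set -/

open Classical in
/-- The numbers of the instance of Fair Division made from an instance of Independent Set. -/
noncomputable def newNats (K : ℕ) (y : IndepSetInput) : ℕ × ℕ × ℕ :=
  -- In this case `K` vertices remain outside any set of exactly `y.target` vertices.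
  if y.target + K ≤ y.n then (y.target, 1, y.target)
  -- With all profits zero, target `0` is always reached and target `1` never.
  else if ∃ X : Finset (Fin y.n), y.graph.IsIndepSet X ∧ y.target ≤ X.card then (0, 0, 0)
  else (1, 0, 0)

/-- The instance of Fair Division made from an instance of Independent Set. -/
noncomputable def newInput (K : ℕ) (y : IndepSetInput) : FairDivisionInput (K + 1) where
  n := y.n
  graph := y.graph
  profit := Fin.cons (fun _ => (newNats K y).2.1) fun _ _ => (newNats K y).2.2
  target := (newNats K y).1

theorem newNumbers_eq (K : ℕ) (y : IndepSetInput) :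
    newNumbers K (graphFields y.graph ++ [encodeNat y.target] ++ [[]]) =
      (encodeNat (newNats K y).1, encodeNat (newNats K y).2.1, encodeNat (newNats K y).2.2) := by
  classical
  rw [List.append_assoc]
  have h1 : val (numVerticesBinary (graphFields y.graph ++ ([encodeNat y.target] ++ [[]]))) = y.n := by
    rw [numVerticesBinary, matrix_graphFields, List.map_ofFn, List.map_ofFn]
    refine (val_sumSelected (fun _ => [true]) fun _ => true).trans ?_
    simp [val]
  have h0 : encodeNat 0 = [] := rfl
  have h0' : encodeNat 1 = [true] := rfl
  rw [newNumbers, afterGraph_graphFields, newNats]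
  by_cases h : y.target + K ≤ y.n
  · have h2 : le (add (([encodeNat y.target] ++ [[]]).headD []) (encodeNat K))
        (numVerticesBinary (graphFields y.graph ++ ([encodeNat y.target] ++ [[]]))) = true := by
      rw [le_iff, h1, val_add]
      simpa [val_encodeNat] using h
    rw [h2, if_pos h, cond_true, h0']
    rfl
  · have h2 : le (add (([encodeNat y.target] ++ [[]]).headD []) (encodeNat K))
        (numVerticesBinary (graphFields y.graph ++ ([encodeNat y.target] ++ [[]]))) = false := by
      rw [← Bool.not_eq_true, le_iff, h1, val_add]
      simpa [val_encodeNat] using h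
    rw [h2, if_neg h, cond_false]
    have h3 := search_graphFields_iff y.graph ([encodeNat y.target] ++ [[]])
      (([encodeNat y.target] ++ [[]]).headD []) K (by simp [val_encodeNat]; omega)
    simp only [List.cons_append, List.headD_cons, val_encodeNat] at h3
    simp only [List.cons_append, List.headD_cons]
    by_cases h4 : ∃ X : Finset (Fin y.n), y.graph.IsIndepSet X ∧ y.target ≤ X.card
    · rw [h3.mpr h4, if_pos h4, cond_true, h0]
    · rw [Bool.eq_false_iff.mpr (fun e => h4 (h3.mp e)), if_neg h4, cond_false, h0, h0']

theorem encodeFields_reduce (K : ℕ) (y : IndepSetInput) :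
    encodeFields (reduce K (graphFields y.graph ++ [encodeNat y.target] ++ [[]])) =
      (newInput K y).encode := by
  classical
  rw [FairDivisionInput.encode, reduce, newNumbers_eq, List.append_assoc, matrix_graphFields]
  have h1 : profitFields (newInput K y).profit =
      ((List.ofFn fun u => List.ofFn fun v => decide (y.graph.Adj u v)).map
        (fun _ => encodeNat (newNats K y).2.1)) ++
      (List.replicate K ((List.ofFn fun u => List.ofFn fun v => decide (y.graph.Adj u v)).map
        fun _ => encodeNat (newNats K y).2.2)).flatten := by
    simp only [profitFields, newInput, List.ofFn_succ (n := K), List.flatten_cons, Fin.cons_zero,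
      Fin.cons_succ, List.ofFn_const, List.map_ofFn, Function.comp_def]
  rw [h1]
  simp [graphFields, newInput]
  congr!

theorem newInput_correct (K : ℕ) (y : IndepSetInput) :
    (∃ X : Finset (Fin y.n), y.graph.IsIndepSet X ∧ y.target ≤ X.card) ↔
      ∃ X : Fin (K + 1) → Finset (Fin y.n), IsPartialColoring y.graph X ∧
        (newInput K y).target ≤ satisfactionLevel (newInput K y).profit X := by
  classical
  simp only [le_satisfactionLevel_iff (Nat.le_add_left 1 K), newInput, Fin.forall_fin_succ,
    Fin.cons_zero, Fin.cons_succ, Finset.sum_const, smul_eq_mul]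
  rw [newNats]
  split_ifs with h1 h2
  · constructor
    · rintro ⟨X, hX, hq⟩
      -- Shrinking to exactly `y.target` vertices guarantees that at least `K` vertices stay free.
      obtain ⟨Y, hYX, hY⟩ := Finset.exists_subset_card_eq hq
      have hc : K ≤ (Yᶜ).card := by
        rw [Finset.card_compl, Fintype.card_fin]; omega
      -- One free vertex for each of the other agents, distinct by injectivity; its profit alone
      -- equals the target.
      let e := (Yᶜ).orderEmbOfCardLe hc
      have he : ∀ j, e j ∉ Y := fun j => by
        simpa using Finset.orderEmbOfCardLe_mem Yᶜ hc j
      refine ⟨Fin.cons Y fun j => {e j}, ⟨?_, ?_⟩, by simp [hY], fun j => by simp⟩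
      · intro i j
        refine Fin.cases (Fin.cases ?_ (fun j => ?_) j) (fun i => Fin.cases ?_ (fun j => ?_) j) i
        · simp
        · simpa using fun _ => he j
        · simpa using he i
        · intro hij
          simp only [Fin.cons_succ, Finset.disjoint_singleton]
          exact fun h => hij (congrArg Fin.succ (e.injective h))
      · intro j
        refine Fin.cases ?_ (fun j => ?_) j
        · exact hX.mono (by simpa using hYX)
        · simp
    · rintro ⟨X, hX, h0, -⟩
      exact ⟨X 0, hX.2 0, by simpa using h0⟩
  · exact ⟨fun _ => ⟨fun _ => ∅, ⟨fun _ _ _ => by simp, fun _ => by simp⟩, by simp⟩, fun _ => h2⟩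
  · refine ⟨fun h => absurd h h2, ?_⟩
    rintro ⟨X, -, h0, -⟩
    simp at h0

/-- The summand `1` is there for graphs without vertices, where the number `1` can still occur. -/
theorem newNats_le (K : ℕ) (y : IndepSetInput) :
    (newNats K y).1 ≤ y.n + 1 ∧ (newNats K y).2.1 ≤ y.n + 1 ∧ (newNats K y).2.2 ≤ y.n + 1 := by
  rw [newNats]
  split_ifs <;> refine ⟨?_, ?_, ?_⟩ <;> simp <;> omega

end StackMachine

/-! ### Strong NP-completeness -/

open StackMachine

/-- Since the reduction does not change the graph, the new instance stays in the class. The bound on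
the numbers is the polynomial `X`, the input length itself. -/
theorem fairDivision_stronglyNPComplete (𝒢 : GraphClass) (h𝒢 : (IndependentSet 𝒢).NPComplete)
    (k : ℕ) (hk : 1 ≤ k) : (FairDivision k 𝒢).StronglyNPComplete := by
  refine ⟨inNP_of_fairDivision hk _ (fun x => x.1) (fun _ => rfl) (fun _ => Iff.rfl),
    Polynomial.X, inNP_of_fairDivision hk _ (fun x => x.1.1) (fun _ => rfl) (fun _ => Iff.rfl), ?_⟩
  intro L hL
  obtain ⟨f, ⟨hf⟩, hyes⟩ := h𝒢.2 L hL
  obtain ⟨K, rfl⟩ : ∃ K, k = K + 1 := ⟨k - 1, by omega⟩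
  have hmax : ∀ y : (IndependentSet 𝒢).Inst,
      (FairDivision (K + 1) 𝒢).maxNum ⟨newInput K y.1, y.2⟩ ≤ (Polynomial.X : Polynomial ℕ).eval
        ((FairDivision (K + 1) 𝒢).enc ⟨newInput K y.1, y.2⟩).length := by
    intro y
    have h1 := lt_length_encodeFields y.1.graph
      (profitFields (newInput K y.1).profit ++ [encodeNat (newInput K y.1).target])
    obtain ⟨h2, h3, h4⟩ := newNats_le K y.1
    rw [Polynomial.eval_X]
    -- The strict inequality `h1` is used as `n + 1 ≤ length`, which matches the bounds of
    -- `newNats_le`.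
    refine le_trans (b := y.1.n + 1) (max_le h2 (Finset.sup_le fun j _ => Finset.sup_le fun v _ => ?_)) h1
    refine Fin.cases ?_ (fun j => ?_) j
    · exact h3
    · exact h4
  refine ⟨fun a => ⟨⟨newInput K (f a).1, (f a).2⟩, hmax (f a)⟩,
    computableInPolyTime_of_polyTime hf letterBit bitLetter
      (g := fun l => joinFields (reduce K (splitFields l)))
      (.joinFields ((PolyTime.reduce K).comp (.splitFields .id))) _ fun a => ?_, fun a => ?_⟩
  · rw [joinFields_encodeFields]
    change _ = encodeFields (reduce K (splitFields (((f a).1.encode).map letterBit).reverse))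
    rw [IndepSetInput.encode, splitFields_encodeFields, encodeFields_reduce]
    rfl
  · rw [hyes]
    exact newInput_correct K (f a).1

/-! ### Sustainability of the class of `H`-free graphs -/

namespace SimpleGraph

/-- The graph `G` together with a new vertex `none`, which is adjacent to all old vertices if
`b` holds and to none of them otherwise. -/
def addVertex {V : Type*} (G : SimpleGraph V) (b : Prop) : SimpleGraph (Option V) where
  Adj
    | none, none => False
    | none, some _ => b
    | some _, none => b
    | some u, some v => G.Adj u v
  symm := ⟨by rintro (_ | u) (_ | v) h; exacts [h, h, h, SimpleGraph.Adj.symm h]⟩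
  loopless := ⟨by rintro (_ | u) h; exacts [h, G.loopless.irrefl u h]⟩

/-- Deleting the new vertex gives back the old graph. -/
def induceAddVertexIso {V : Type*} (G : SimpleGraph V) (b : Prop) :
    (G.addVertex b).induce {none}ᶜ ≃g G where
  toFun x := x.1.get (Option.isSome_iff_ne_none.mpr x.2)
  invFun v := ⟨some v, by simp⟩
  left_inv := by rintro ⟨_ | v, h⟩ <;> simp at h ⊢
  right_inv v := by simp
  map_rel_iff' := by
    rintro ⟨_ | u, hu⟩ ⟨_ | v, hv⟩ <;> simp at hu hv ⊢
    rfl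

/-- If every vertex `w` of `H` has another vertex `u` such that `H.Adj w u` fails to be equivalent
to `b`, then no induced copy of `H` in `G.addVertex b` uses the new vertex. -/
theorem IsIndContained.of_addVertex {V W : Type*} {G : SimpleGraph V} {H : SimpleGraph W} {b : Prop}
    (hb : ∀ w, ∃ u ≠ w, ¬ (H.Adj w u ↔ b)) (h : H.IsIndContained (G.addVertex b)) :
    H.IsIndContained G := by
  obtain ⟨e⟩ := h
  -- If `w` were sent to the new vertex, its adjacency to every other vertex of `H` would be given
  -- by `b`, against `hb`.
  have hn : ∀ w, e w ≠ none := by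
    intro w hw
    obtain ⟨u, hu, h⟩ := hb w
    refine h ?_
    rw [← e.map_adj_iff, hw]
    cases hu' : e u with
    | none => exact absurd (e.injective (hu'.trans hw.symm)) hu
    | some v => exact Iff.rfl
  choose f hf using fun w => Option.ne_none_iff_exists'.mp (hn w)
  refine ⟨⟨⟨f, fun w w' h => e.injective (by rw [hf, hf, h])⟩, ?_⟩⟩
  intro w w'
  rw [← e.map_adj_iff, hf, hf]
  rfl

/-- In a graph with at least two vertices, either no vertex is isolated or no vertex is
universal. -/
theorem exists_forall_exists_ne {W : Type*} [Nontrivial W] (H : SimpleGraph W) :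
    ∃ b : Prop, ∀ w, ∃ u ≠ w, ¬ (H.Adj w u ↔ b) := by
  by_cases h : ∀ w, ∃ u ≠ w, H.Adj w u
  · exact ⟨False, fun w => (h w).imp fun u hu => ⟨hu.1, by simpa using hu.2⟩⟩
  · push Not at h
    obtain ⟨w₀, h₀⟩ := h
    -- The vertex `w₀` is isolated, so every other vertex has `w₀` as a non-neighbor; `w₀` itself
    -- has one because there is a second vertex.
    refine ⟨True, fun w => ?_⟩
    by_cases hw : w = w₀
    · obtain ⟨u, hu⟩ := exists_ne w
      exact ⟨u, hu, by simpa [hw] using h₀ u (hw ▸ hu)⟩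
    · exact ⟨w₀, Ne.symm hw, by simpa [H.adj_comm] using h₀ w hw⟩

end SimpleGraph

/-- The kind `b` of the new vertex is chosen according to `H`; what remains is the transport from
`Option (Fin n)` to `Fin (n + 1)`. -/
theorem GraphClass.free_sustainable {W : Type*} [Nontrivial W] (H : SimpleGraph W) :
    (GraphClass.free H).Sustainable := by
  intro n G hG
  obtain ⟨b, hb⟩ := H.exists_forall_exists_ne
  let e : Option (Fin n) ≃ Fin (n + 1) := (finSuccEquiv n).symm
  let i : (G.addVertex b).map e.toEmbedding ≃g G.addVertex b :=
    (SimpleGraph.Iso.map e (G.addVertex b)).symm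
  refine ⟨n + 1, (G.addVertex b).map e.toEmbedding, e none, ?_, ⟨?_⟩⟩
  · rintro ⟨f⟩
    exact hG (SimpleGraph.IsIndContained.of_addVertex hb ⟨i.toEmbedding.comp f⟩)
  · refine RelIso.trans ?_ (G.induceAddVertexIso b)
    refine ⟨i.toEquiv.subtypeEquiv fun x => ?_, fun {x y} => i.map_rel_iff⟩
    change ¬ x = e none ↔ ¬ e.symm x = none
    rw [e.symm_apply_eq]

theorem corollary1 :
    (∀ 𝒢 : GraphClass, 𝒢.Sustainable → (IndependentSet 𝒢).NPComplete →
      ∀ k : ℕ, 1 ≤ k → (FairDivision k 𝒢).StronglyNPComplete) ∧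
    (∀ (W : Type*) [Finite W] (H : SimpleGraph W), 2 ≤ Nat.card W →
      (GraphClass.free H).Sustainable ∧
      ((IndependentSet (GraphClass.free H)).NPComplete →
        ∀ k : ℕ, 1 ≤ k → (FairDivision k (GraphClass.free H)).StronglyNPComplete)) := by
  refine ⟨fun 𝒢 _ h𝒢 k hk => fairDivision_stronglyNPComplete 𝒢 h𝒢 k hk, fun W _ H hW => ?_⟩
  have : Nontrivial W := Finite.one_lt_card_iff_nontrivial.mp hW
  exact ⟨GraphClass.free_sustainable H, fun h k hk => fairDivision_stronglyNPComplete _ h k hk⟩
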